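/- **Definitions.** Graphs are finite multigraphs (loops and parallel edges allowed). For a finite set $S$, an ordering of $S$ is a bijection $S\to\{1,\dots,|S|\}$. *Minimum latency vertex cover (MLVC):* given a graph $G=(V,E)$, find an ordering $\pi$ of $V$ minimizing $$\mathrm{MLVC}(G,\pi)=\sum_{uv\in E}\max\{\pi(u),\pi(v)\}.$$ Decision form: given $(G,K)$ with $K\in\mathbb{N}$, is there an ordering $\pi$ with $\mathrm{MLVC}(G,\pi)\le K$? *Graphic matroid minimum linear ordering problem (graphic matroid MLOP):* given a graph $H=(V,E)$, find an ordering $\sigma$ of $E$ minimizing $$\mathrm{MLOP}(H,\sigma)=\sum_{i=1}^{|E|} r\big(\{e\in E:\sigma(e)\le i\}\big),$$ where $r$ is the rank function of the graphic matroid $M[H]$ (the matroid on $E$ whose independent sets are the acyclic edge sets). Decision form: given $(H,K)$, is there an ordering $\sigma$ with $\mathrm{MLOP}(H,\sigma)\le K$? Graphs are encoded as bit strings listing the number of vertices and the two ends of every edge (in unary), thresholds $K$ are encoded in binary, and orderings are encoded by listing the elements in order. Polynomial time means polynomial time on a Turing machine, in the length of the encoded input. **Theorem.** MLVC reduces in polynomial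 time to graphic matroid MLOP, in decision form and as an optimization problem. That is, there are a map $f$ from graphs to graphs, a map $d$ from graphs to $\mathbb{N}$, and for each graph $G$ a map $g_G$ from orderings of $E(f(G))$ to orderings of $V(G)$, such that 1. the maps $G\mapsto f(G)$, $(G,K)\mapsto (f(G),K+d(G))$ and $(G,\sigma)\mapsto g_G(\sigma)$ are computable in polynomial time; 2. for every graph $G$ and every $K\in\mathbb{N}$, there is an ordering $\pi$ of $V(G)$ with $\mathrm{MLVC}(G,\pi)\le K$ if and only if there is an ordering $\sigma$ of $E(f(G))$ with $\mathrm{MLOP}(f(G),\sigma)\le K+d(G)$; 3. for every graph $G$, if $\sigma$ is an ordering of $E(f(G))$ minimizing $\mathrm{MLOP}(f(G),\cdot)$, then $g_G(\sigma)$ is an ordering of $V(G)$ minimizing $\mathrm{MLVC}(G,\cdot)$. -/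

import Mathlib

open Computability

/-- A finite multigraph with vertex set `{0, …, n - 1}`; loops and parallel edges are allowed.
The multiset of edges is presented as a list of pairs of end vertices. -/
structure MultiGraph where
  /-- the number of vertices -/
  n : ℕ
  /-- the edges -/
  edges : List (Fin n × Fin n)

namespace MultiGraph

/-- The number of edges; the edges are indexed by `Fin G.m`. -/
abbrev m (G : MultiGraph) : ℕ := G.edges.length

/-- The unordered pair of end vertices of an edge. -/
def ends (G : MultiGraph) (e : Fin G.m) : Sym2 (Fin G.n) :=
  s((G.edges.get e).1, (G.edges.get e).2)

/-- The edge set `A` contains a cycle: distinct vertices `v 0, …, v k` and distinct edges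
`e 0, …, e k` of `A` such that `e i` joins `v i` and `v (i + 1)`, indices modulo `k + 1`.
For `k = 0` this is a loop, for `k = 1` a pair of parallel edges. -/
def HasCycle (G : MultiGraph) (A : Set (Fin G.m)) : Prop :=
  ∃ (k : ℕ) (v : Fin (k + 1) → Fin G.n) (e : Fin (k + 1) → Fin G.m),
    Function.Injective v ∧ Function.Injective e ∧
      ∀ i, e i ∈ A ∧ G.ends (e i) = s(v i, v (i + 1))

/-- The edge set `A` is acyclic (a forest). -/
def IsAcyclic (G : MultiGraph) (A : Set (Fin G.m)) : Prop := ¬ G.HasCycle A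

/-- Mod 2 incidence vector of an edge (used only to verify the matroid axioms below). -/
def incVec (G : MultiGraph) (e : Fin G.m) : Fin G.n → ZMod 2 :=
  Pi.single (G.edges.get e).1 1 + Pi.single (G.edges.get e).2 1

lemma incVec_eq (G : MultiGraph) {e : Fin G.m} {a b : Fin G.n} (h : G.ends e = s(a, b)) :
    G.incVec e = Pi.single a 1 + Pi.single b 1 := by
  unfold ends at h
  rcases Sym2.eq_iff.1 h with ⟨h1, h2⟩ | ⟨h1, h2⟩
  · simp only [incVec, h1, h2]
  · simp only [incVec, h1, h2, add_comm]

lemma IsAcyclic.of_linearIndepOn (G : MultiGraph) {A : Set (Fin G.m)}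
    (h : LinearIndepOn (ZMod 2) G.incVec A) : G.IsAcyclic A := by
  rintro ⟨k, v, e, -, he, hve⟩
  have h1 : LinearIndependent (ZMod 2) (fun i => G.incVec (e i)) :=
    h.comp (fun i => (⟨e i, (hve i).1⟩ : A)) (fun i j hij => he (by simpa using hij))
  have h2 : ∑ i, (1 : ZMod 2) • G.incVec (e i) = 0 := by
    simp only [one_smul, fun i => G.incVec_eq (hve i).2, Finset.sum_add_distrib]
    have h3 := Equiv.sum_comp (Equiv.addRight (1 : Fin (k + 1)))
      (fun j => (Pi.single (v j) 1 : Fin G.n → ZMod 2))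
    simp only [Equiv.coe_addRight] at h3
    rw [h3]
    funext x
    exact CharTwo.add_self_eq_zero _
  exact one_ne_zero (Fintype.linearIndependent_iff.1 h1 (fun _ => 1) h2 0)

lemma IsAcyclic.linearIndepOn (G : MultiGraph) {A : Set (Fin G.m)}
    (h : G.IsAcyclic A) : LinearIndepOn (ZMod 2) G.incVec A := by
  classical
  rw [linearIndepOn_iff_notMem_span]
  intro e he hspan
  apply h
  let S : SimpleGraph (Fin G.n) := SimpleGraph.fromRel fun a b => ∃ f ∈ A \ {e}, G.ends f = s(a, b)
  obtain ⟨a, b, hab⟩ : ∃ a b, G.ends e = s(a, b) := ⟨_, _, rfl⟩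
  have hreach : S.Reachable a b := by
    by_contra hn
    let φ : (Fin G.n → ZMod 2) →ₗ[ZMod 2] ZMod 2 :=
      ∑ x ∈ Finset.univ.filter (S.Reachable a), LinearMap.proj x
    have hφ : ∀ x, φ (Pi.single x 1) = if S.Reachable a x then 1 else 0 := by
      intro x
      simp [φ, LinearMap.sum_apply, Pi.single_apply, Finset.sum_ite_eq']
    have hker : Submodule.span (ZMod 2) (G.incVec '' (A \ {e})) ≤ LinearMap.ker φ := by
      rw [Submodule.span_le]
      rintro _ ⟨f, hf, rfl⟩
      obtain ⟨c, d, hcd⟩ : ∃ c d, G.ends f = s(c, d) := ⟨_, _, rfl⟩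
      have hcd' : S.Reachable c d := by
        by_cases hne : c = d
        · subst hne; exact SimpleGraph.Reachable.refl _
        · exact SimpleGraph.Adj.reachable
            ((SimpleGraph.fromRel_adj _ _ _).2 ⟨hne, Or.inl ⟨f, hf, hcd⟩⟩)
      have : S.Reachable a c ↔ S.Reachable a d :=
        ⟨fun h => h.trans hcd', fun h => h.trans hcd'.symm⟩
      simp only [SetLike.mem_coe, LinearMap.mem_ker, G.incVec_eq hcd, map_add, hφ, this]
      exact CharTwo.add_self_eq_zero _
    have := hker hspan
    rw [LinearMap.mem_ker, G.incVec_eq hab, map_add, hφ, hφ,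
      if_pos (SimpleGraph.Reachable.refl a), if_neg hn] at this
    simp at this
  obtain ⟨p, hp⟩ := hreach.exists_isPath
  have hadj : ∀ i, i < p.length → ∃ f ∈ A \ {e}, G.ends f = s(p.getVert i, p.getVert (i + 1)) := by
    intro i hi
    rcases ((SimpleGraph.fromRel_adj _ _ _).1 (p.adj_getVert_succ hi)).2 with h | h
    · exact h
    · obtain ⟨f, hf, hf'⟩ := h
      exact ⟨f, hf, hf'.trans Sym2.eq_swap⟩
  have : Nonempty (Fin G.m) := ⟨e⟩
  choose! F hFA hF using hadj
  have hinj : ∀ i j, i ≤ p.length → j ≤ p.length → p.getVert i = p.getVert j → i = j :=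
    fun i j hi hj hij => hp.getVert_injOn hi hj hij
  refine ⟨p.length, fun i => p.getVert i,
    fun i => if (i : ℕ) < p.length then F i else e, ?_, ?_, ?_⟩
  · intro i j hij
    exact Fin.ext (hinj i j (by omega) (by omega) hij)
  · intro i j hij
    simp only at hij
    have key : ∀ i j : ℕ, i < p.length → j < p.length → F i = F j → i = j := by
      intro i j hi hj hij
      have := (hF i hi).symm.trans ((congrArg G.ends hij).trans (hF j hj))
      rcases Sym2.eq_iff.1 this with ⟨h1, -⟩ | ⟨h1, h2⟩
      · exact hinj _ _ hi.le hj.le h1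
      · have h3 := hinj _ _ hi.le hj h1
        have h4 := hinj _ _ hi hj.le h2
        omega
    split_ifs at hij with h1 h2 h2
    · exact Fin.ext (key _ _ h1 h2 hij)
    · exact absurd hij (hFA _ h1).2
    · exact absurd hij.symm (hFA _ h2).2
    · exact Fin.ext (by omega)
  · intro i
    by_cases hi : (i : ℕ) < p.length
    · have hs : ((i + 1 : Fin (p.length + 1)) : ℕ) = i + 1 := by
        rw [Fin.val_add_one_of_lt]
        exact Fin.lt_def.2 (by simpa using hi)
      simp only [hi, if_true, hs]
      exact ⟨(hFA _ hi).1, hF _ hi⟩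
    · have hl : i = Fin.last _ := Fin.ext (by simp; omega)
      subst hl
      simp [he, hab, Sym2.eq_swap]

/-- The graphic matroid `M[G]`: its ground set is the edge set of `G`, its independent sets are
the acyclic edge sets. -/
def graphicMatroid (G : MultiGraph) : Matroid (Fin G.m) :=
  (IndepMatroid.ofFinite (E := Set.univ) Set.finite_univ G.IsAcyclic
    (IsAcyclic.of_linearIndepOn G (linearIndepOn_empty _ _))
    (fun _ _ hJ hIJ =>
      IsAcyclic.of_linearIndepOn G ((IsAcyclic.linearIndepOn G hJ).mono hIJ))
    (by
      intro I J hI hJ hlt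
      have hI' := IsAcyclic.linearIndepOn G hI
      have hJ' := IsAcyclic.linearIndepOn G hJ
      by_contra! hcon
      have hsub : G.incVec '' J ⊆ Submodule.span (ZMod 2) (G.incVec '' I) := by
        rintro _ ⟨e, he, rfl⟩
        by_cases heI : e ∈ I
        · exact Submodule.subset_span ⟨e, heI, rfl⟩
        · by_contra hns
          exact hcon e he heI (IsAcyclic.of_linearIndepOn G
            ((linearIndepOn_insert heI).2 ⟨hI', hns⟩))
      have h1 := Submodule.finrank_mono (Submodule.span_le.2 hsub)
      have hfr : ∀ K : Set (Fin G.m), LinearIndepOn (ZMod 2) G.incVec K →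
          Module.finrank (ZMod 2) (Submodule.span (ZMod 2) (G.incVec '' K)) = K.ncard := by
        intro K hK
        classical
        have := finrank_span_eq_card (R := ZMod 2) (b := fun x : K => G.incVec x) hK
        rw [Set.image_eq_range, this, ← Nat.card_eq_fintype_card, Nat.card_coe_set_eq]
      rw [hfr J hJ', hfr I hI'] at h1
      omega)
    (fun _ _ => Set.subset_univ _)).matroid

/-- The rank function of the graphic matroid of `G` (a natural number: the ground set is finite). -/
noncomputable def graphicRank (G : MultiGraph) (A : Set (Fin G.m)) : ℕ :=
  (G.graphicMatroid.eRk A).toNat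

end MultiGraph

/-- An ordering of `{0, …, N - 1}`: a bijection onto the `N` positions. -/
abbrev LinOrdering (N : ℕ) : Type := Equiv.Perm (Fin N)

/-- The position of `x` in an ordering, a number in `{1, …, N}`. -/
def LinOrdering.pos {N : ℕ} (σ : LinOrdering N) (x : Fin N) : ℕ := (σ x : ℕ) + 1

/-- The MLVC objective: the sum over all edges `uv` of `max (π u) (π v)`. -/
def mlvcCost (G : MultiGraph) (π : LinOrdering G.n) : ℕ :=
  (G.edges.map fun e => max (LinOrdering.pos π e.1) (LinOrdering.pos π e.2)).sum

/-- The MLOP objective of a set function `r`: the sum of `r` over all prefixes of the ordering. -/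
def mlopCost {N : ℕ} (r : Set (Fin N) → ℕ) (σ : LinOrdering N) : ℕ :=
  ∑ i ∈ Finset.Icc 1 N, r {e | LinOrdering.pos σ e ≤ i}

/-- The objective of graphic matroid MLOP on `H`. -/
noncomputable def graphicMlopCost (H : MultiGraph) (σ : LinOrdering H.m) : ℕ :=
  mlopCost H.graphicRank σ

/-- `s` minimizes `cost`. -/
def IsOptimal {S : Type} (cost : S → ℕ) (s : S) : Prop := ∀ t, cost s ≤ cost t

/-- A list of natural numbers as a bit string, `k` being written as `k` ones followed by a zero. -/
def encodeNatList (l : List ℕ) : List Bool :=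
  l.flatMap fun k => List.replicate k true ++ [false]

/-- Left inverse of `encodeNatList`; the first argument is the length of the current block. -/
def decodeNatList : ℕ → List Bool → List ℕ
  | _, [] => []
  | k, true :: l => decodeNatList (k + 1) l
  | k, false :: l => k :: decodeNatList 0 l

lemma decodeNatList_replicate (k j : ℕ) (l : List Bool) :
    decodeNatList j (List.replicate k true ++ false :: l) = (j + k) :: decodeNatList 0 l := by
  induction k generalizing j with
  | zero => simp [decodeNatList]
  | succ k ih =>
    simp only [List.replicate_succ, List.cons_append, decodeNatList, ih]
    congr 1
    omega

lemma decodeNatList_encode (l : List ℕ) : decodeNatList 0 (encodeNatList l) = l := by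
  induction l with
  | nil => rfl
  | cons a l ih =>
    have : encodeNatList (a :: l) = List.replicate a true ++ false :: encodeNatList l := by
      simp [encodeNatList]
    rw [this, decodeNatList_replicate, ih, Nat.zero_add]

/-- Auxiliary parser: read a list of numbers as a list of pairs of vertices. -/
def parsePairs (n : ℕ) : List ℕ → List (Fin n × Fin n)
  | u :: v :: l =>
    if h : u < n ∧ v < n then (⟨u, h.1⟩, ⟨v, h.2⟩) :: parsePairs n l else parsePairs n l
  | _ => []

/-- The encoding of a multigraph as a bit string: the number of vertices, followed by the two ends
of each edge, all numbers in unary. Its length is between `n + m` and `1 + n + 2 m n`, so it is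
polynomially equivalent to adjacency lists. -/
def encodingMultiGraph : Encoding MultiGraph Bool where
  encode G := encodeNatList (G.n :: G.edges.flatMap fun e => [(e.1 : ℕ), (e.2 : ℕ)])
  decode s := match decodeNatList 0 s with
    | [] => none
    | n :: l => some ⟨n, parsePairs n l⟩
  decode_encode := by
    rintro ⟨n, l⟩
    rw [decodeNatList_encode]
    have : parsePairs n (l.flatMap fun e => [(e.1 : ℕ), (e.2 : ℕ)]) = l := by
      induction l with
      | nil => rfl
      | cons e l ih => simp [parsePairs, ih]
    simp [this]

/-- Instances of the decision problems: a multigraph together with a threshold in binary. -/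
def encodingMultiGraphNat : Encoding (MultiGraph × ℕ) (Bool ⊕ Bool) :=
  encodingProd encodingMultiGraph encodingNatBool

/-- The encoding of an ordering as a bit string: the elements are listed (in unary) in the order in
which they appear. -/
def encodeOrdering {N : ℕ} (σ : LinOrdering N) : List Bool :=
  encodeNatList ((List.finRange N).map fun i => (σ.symm i : ℕ))

/-- The encoding of a multigraph `G` together with an ordering of the edges of `f G`. -/
def encodeWithOrdering (f : MultiGraph → MultiGraph) (p : Σ G : MultiGraph, LinOrdering (f G).m) :
    List (Bool ⊕ Bool) :=
  (encodingMultiGraph.encode p.1).map Sum.inl ++ (encodeOrdering p.2).map Sum.inr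

/-- `f` is computed by a Turing machine in time polynomial in the length of the encoded input. -/
def PolyTimeComputable {α β A B : Type} (ea : α → List A) (eb : β → List B) (f : α → β) : Prop :=
  Nonempty (Turing.TM2ComputableInPolyTime ea eb f)

/-!
The reduction sends a multigraph `G` with `n` vertices and `m` edges to the cone over `G`: a new
vertex, the root, is joined to every vertex by `m * n + 1` parallel edges, which make up `m * n + 1`
copies of the spokes, and every loop of `G` becomes an edge to the root. The threshold is shifted by
`(m * n + 1) * (1 + ⋯ + n)`.

Correctness. The cost of an edge ordering is the sum over the edges of the rank of the prefix that
ends in the edge (`graphicMlopCost_eq_sum`), and the rank is the dimension of the span of the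
incidence vectors over `ZMod 2` (`MultiGraph.graphicRank_eq_finrank`). Let a vertex ordering `π` be
given, and let the level of an edge be the larger of the positions of its ends, the root having
position `0`. The sum of the levels in the cone is the shift plus the MLVC objective of `π`
(`MultiGraph.sum_level_cone`), and sorting the edges by level costs no more: a prefix ending in
level `k` touches at most `k` vertices besides the root, so that its rank is at most `k`
(`exists_graphicMlopCost_le_sum_level`).

Conversely, let an edge ordering be given. A copy of the spokes defines an ordering of the vertices,
and the `k`-th spoke of the copy costs at least `k` since the spokes are independent
(`pos_le_edgeCost_spoke`); so the copy costs at least `1 + ⋯ + n`. If it costs no more than that,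
then every edge of `G` costs at least its level with respect to the ordering defined by the copy
(`level_le_edgeCost`). If all copies cost more, the total exceeds the shift by at least `m * n + 1`,
which is more than the MLVC objective of any ordering. This gives the correspondence of the decision
problems (`MultiGraph.exists_mlvcCost_le_iff`). In an optimal edge ordering some copy therefore has
the least cost, and comparing with the upper bound shows that all copies have it. Hence every copy
defines an optimal vertex ordering (`MultiGraph.isOptimal_copyOrdering`); the copy `0` is used for
carrying orderings back. Its spokes are the edges with the numbers `0, …, n - 1`, so the list of
vertices is obtained from the list of edges by deleting all numbers `≥ n`
(`MultiGraph.map_finRange_pullback`).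

Polynomial time. The machine model is Mathlib's `Turing.TM2`, a machine with finitely many stacks.
The machines are obtained from structured programs (`StackProgram.Cmd`), built from pushes and from
loops that pop a symbol in each round. Such a program has a big-step semantics with time
(`StackProgram.Cmd.Exec`), which its compilation to a machine simulates step by step
(`StackProgram.Cmd.Exec.iterate_step`). What remains are programs that write the encoding of the
cone (`StackProgram.does_coneProgram`), increment a binary number
(`StackProgram.does_each_increment`) and filter a list of numbers (`StackProgram.does_filterLoop`).
The bounds for the time that the cone takes, for its size and for the shift are expressions in `n`
and `m` over an arbitrary commutative semiring; evaluated at the variable of `ℕ[X]` they give the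
required polynomials.
-/

/-! ### The rank of the graphic matroid -/

namespace MultiGraph

lemma isAcyclic_iff_linearIndepOn (G : MultiGraph) (A : Set (Fin G.m)) :
    G.IsAcyclic A ↔ LinearIndepOn (ZMod 2) G.incVec A :=
  ⟨IsAcyclic.linearIndepOn G, IsAcyclic.of_linearIndepOn G⟩

/-- The graphic matroid is represented over `ZMod 2` by the incidence vectors. -/
lemma graphicRank_eq_finrank (G : MultiGraph) (A : Set (Fin G.m)) :
    G.graphicRank A = Module.finrank (ZMod 2) (Submodule.span (ZMod 2) (G.incVec '' A)) := by
  classical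
  obtain ⟨I, hI⟩ := G.graphicMatroid.exists_isBasis A (Set.subset_univ _)
  have hind : ∀ J : Set (Fin G.m), G.graphicMatroid.Indep J ↔
      LinearIndepOn (ZMod 2) G.incVec J := by
    intro J
    rw [← isAcyclic_iff_linearIndepOn]
    simp [graphicMatroid]
  have hII := (hind I).1 hI.indep
  have hspan : Submodule.span (ZMod 2) (G.incVec '' A) =
      Submodule.span (ZMod 2) (G.incVec '' I) := by
    refine le_antisymm ?_ (Submodule.span_mono (Set.image_mono hI.subset))
    rw [Submodule.span_le]
    rintro _ ⟨e, he, rfl⟩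
    by_contra hns
    have heI : e ∉ I := fun h => hns (Submodule.subset_span ⟨e, h, rfl⟩)
    exact heI (hI.mem_of_insert_indep he ((hind _).2 ((linearIndepOn_insert heI).2 ⟨hII, hns⟩)))
  have h1 := finrank_span_eq_card (R := ZMod 2) (b := fun x : I => G.incVec x) hII
  rw [hspan, graphicRank, hI.eRk_eq_encard, Set.image_eq_range, h1, ← Nat.card_eq_fintype_card,
    Nat.card_coe_set_eq, Set.ncard]

end MultiGraph

/-- The mod 2 incidence vector of an edge between the vertices `0` and `x`. -/
def rootVec {n : ℕ} (x : Fin (n + 1)) : Fin (n + 1) → ZMod 2 := Pi.single 0 1 + Pi.single x 1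

lemma rootVec_zero {n : ℕ} : rootVec (0 : Fin (n + 1)) = 0 := by
  funext x
  exact CharTwo.add_self_eq_zero _

lemma rootVec_add {n : ℕ} (x y : Fin (n + 1)) :
    rootVec x + rootVec y = Pi.single x 1 + Pi.single y 1 := by
  have h : (Pi.single 0 1 + Pi.single 0 1 : Fin (n + 1) → ZMod 2) = 0 := by
    funext x
    exact CharTwo.add_self_eq_zero _
  rw [rootVec, rootVec, add_add_add_comm, h, zero_add]

lemma rootVec_eq_add_of_add {n : ℕ} (x y : Fin (n + 1)) :
    rootVec x = (rootVec x + rootVec y) + rootVec y := by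
  funext z
  rw [add_assoc]
  simp [CharTwo.add_self_eq_zero]

lemma linearIndependent_rootVec (n : ℕ) :
    LinearIndependent (ZMod 2) (fun v : Fin n => rootVec v.succ) := by
  rw [Fintype.linearIndependent_iff]
  intro c hc v
  have := congrFun hc v.succ
  simpa [rootVec, Pi.single_apply, Finset.sum_apply] using this

namespace MultiGraph

variable {n : ℕ} {E : List (Fin (n + 1) × Fin (n + 1))}

lemma incVec_eq_rootVec_add (e : Fin (MultiGraph.mk (n + 1) E).m) :
    (MultiGraph.mk (n + 1) E).incVec e = rootVec (E.get e).1 + rootVec (E.get e).2 := by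
  rw [rootVec_add]
  rfl

/-- The rank of a set of edges is at most the number of vertices other than the root `0` that it
touches. -/
lemma graphicRank_le_card {A : Set (Fin (MultiGraph.mk (n + 1) E).m)} (T : Finset (Fin n))
    (h : ∀ e ∈ A, ∀ v : Fin n, v.succ = (E.get e).1 ∨ v.succ = (E.get e).2 → v ∈ T) :
    (MultiGraph.mk (n + 1) E).graphicRank A ≤ T.card := by
  classical
  rw [graphicRank_eq_finrank]
  let W := Submodule.span (ZMod 2) ((T.image fun v : Fin n => rootVec v.succ : Finset _) :
    Set (Fin (n + 1) → ZMod 2))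
  have hW : ∀ x : Fin (n + 1), (∀ v : Fin n, v.succ = x → v ∈ T) → rootVec x ∈ W := by
    intro x hx
    induction x using Fin.cases with
    | zero => rw [rootVec_zero]; exact zero_mem _
    | succ v =>
      refine Submodule.subset_span ?_
      simp only [Finset.coe_image, Set.mem_image, Finset.mem_coe]
      exact ⟨v, hx v rfl, rfl⟩
  refine le_trans (Submodule.finrank_mono (t := W) ?_)
    ((finrank_span_finset_le_card _).trans Finset.card_image_le)
  rw [Submodule.span_le]
  rintro _ ⟨e, he, rfl⟩
  rw [SetLike.mem_coe, incVec_eq_rootVec_add]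
  exact add_mem (hW _ fun v hv => h e he v (Or.inl hv)) (hW _ fun v hv => h e he v (Or.inr hv))

/-- The rank of a set of edges is at least the number of vertices whose edge to the root `0` lies in
its span. -/
lemma card_le_graphicRank {A : Set (Fin (MultiGraph.mk (n + 1) E).m)} (T : Finset (Fin n))
    (h : ∀ v ∈ T, rootVec v.succ ∈
      Submodule.span (ZMod 2) ((MultiGraph.mk (n + 1) E).incVec '' A)) :
    T.card ≤ (MultiGraph.mk (n + 1) E).graphicRank A := by
  classical
  rw [graphicRank_eq_finrank]
  have h1 := finrank_span_eq_card (R := ZMod 2) (b := fun v : T => rootVec (v : Fin n).succ)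
    ((linearIndependent_rootVec n).comp _ Subtype.val_injective)
  rw [Fintype.card_coe] at h1
  rw [← h1]
  refine Submodule.finrank_mono (Submodule.span_le.2 ?_)
  rintro _ ⟨v, rfl⟩
  exact h v v.2

end MultiGraph

/-! ### The cost of an ordering as a sum over the edges -/

/-- The contribution of the edge `e` to the objective: the rank of the prefix that ends in `e`. -/
noncomputable def edgeCost (H : MultiGraph) (σ : LinOrdering H.m) (e : Fin H.m) : ℕ :=
  H.graphicRank {e' | σ e' ≤ σ e}

lemma graphicMlopCost_eq_sum (H : MultiGraph) (σ : LinOrdering H.m) :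
    graphicMlopCost H σ = ∑ e, edgeCost H σ e := by
  have h1 : graphicMlopCost H σ =
      ∑ i ∈ Finset.range H.m, H.graphicRank {e | (σ e : ℕ) ≤ i} := by
    rw [graphicMlopCost, mlopCost, Finset.range_eq_Ico, ← Finset.Ico_add_one_right_eq_Icc,
      ← Finset.sum_Ico_add' _ 0 H.m 1]
    refine Finset.sum_congr rfl fun i _ => ?_
    simp [LinOrdering.pos]
  rw [h1, Finset.sum_range, ← Equiv.sum_comp σ]
  rfl

/-- The ordering of `{0, …, N - 1}` by nondecreasing values of `key`. -/
def orderingOf {N : ℕ} {α : Type} [LinearOrder α] (key : Fin N → α) : LinOrdering N :=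
  (Tuple.sort key).symm

lemma key_le_of_orderingOf_le {N : ℕ} {α : Type} [LinearOrder α] (key : Fin N → α) {a b : Fin N}
    (h : orderingOf key a ≤ orderingOf key b) : key a ≤ key b := by
  have := Tuple.monotone_sort key h
  simpa [orderingOf] using this

lemma orderingOf_le_iff {N : ℕ} {α : Type} [LinearOrder α] {key : Fin N → α}
    (hk : Function.Injective key) {a b : Fin N} :
    orderingOf key a ≤ orderingOf key b ↔ key a ≤ key b := by
  refine ⟨key_le_of_orderingOf_le key, fun h => ?_⟩
  by_contra hlt
  have h2 := hk (le_antisymm h (key_le_of_orderingOf_le key (le_of_not_ge hlt)))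
  exact hlt (h2 ▸ le_rfl)

lemma card_filter_pos_le {n : ℕ} (π : LinOrdering n) (k : ℕ) :
    (Finset.univ.filter fun v => LinOrdering.pos π v ≤ k).card ≤ k := by
  have h := Finset.card_le_card_of_injOn (s := Finset.univ.filter fun v => LinOrdering.pos π v ≤ k)
    (t := Finset.range k) (fun v => (π v : ℕ))
    (by intro v hv; simp [LinOrdering.pos] at hv ⊢; omega)
    (by intro a _ b _ hab; exact π.injective (Fin.ext hab))
  simpa using h

lemma card_filter_le {n : ℕ} (π : LinOrdering n) (v : Fin n) :
    (Finset.univ.filter fun w => π w ≤ π v).card = LinOrdering.pos π v := by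
  have : (Finset.univ.filter fun w => π w ≤ π v) = (Finset.Iic (π v)).map π.symm.toEmbedding := by
    ext w
    simp only [Finset.mem_filter, Finset.mem_univ, true_and, Finset.mem_map_equiv, Finset.mem_Iic,
      Equiv.symm_symm]
  rw [this, Finset.card_map, Fin.card_Iic, LinOrdering.pos]

lemma sum_pos {n : ℕ} (π : LinOrdering n) :
    ∑ v, LinOrdering.pos π v = ∑ v : Fin n, ((v : ℕ) + 1) :=
  Equiv.sum_comp π fun v : Fin n => (v : ℕ) + 1

/-! ### The cost of an edge and the positions of its ends -/

/-- The position of a vertex in the ordering `π` of the vertices other than the root `0`; the root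
has position `0`. -/
def rootedPos {n : ℕ} (π : LinOrdering n) : Fin (n + 1) → ℕ := Fin.cases 0 (LinOrdering.pos π)

/-- The larger of the positions of the ends of an edge. -/
def level {n : ℕ} (π : LinOrdering n) (x : Fin (n + 1) × Fin (n + 1)) : ℕ :=
  max (rootedPos π x.1) (rootedPos π x.2)

@[simp] lemma rootedPos_zero {n : ℕ} (π : LinOrdering n) : rootedPos π 0 = 0 := rfl

@[simp] lemma rootedPos_succ {n : ℕ} (π : LinOrdering n) (v : Fin n) :
    rootedPos π v.succ = LinOrdering.pos π v := rfl

lemma rootedPos_injective {n : ℕ} (π : LinOrdering n) : Function.Injective (rootedPos π) := by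
  intro x y h
  induction x using Fin.cases with
  | zero =>
    induction y using Fin.cases with
    | zero => rfl
    | succ v => simp [LinOrdering.pos] at h
  | succ w =>
    induction y using Fin.cases with
    | zero => simp [LinOrdering.pos] at h
    | succ v =>
      simp only [rootedPos_succ, LinOrdering.pos, Nat.add_right_cancel_iff] at h
      rw [π.injective (Fin.ext h)]

/-- Taking the edges by nondecreasing level, every edge costs at most its level. -/
lemma exists_graphicMlopCost_le_sum_level {n : ℕ} (E : List (Fin (n + 1) × Fin (n + 1)))
    (π : LinOrdering n) :
    ∃ σ : LinOrdering (MultiGraph.mk (n + 1) E).m,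
      graphicMlopCost (MultiGraph.mk (n + 1) E) σ ≤ (E.map (level π)).sum := by
  refine ⟨orderingOf fun e => level π (E.get e), ?_⟩
  have h : (E.map (level π)).sum = ∑ e : Fin E.length, level π (E.get e) := by
    rw [← Fin.sum_univ_fun_getElem]
    rfl
  rw [graphicMlopCost_eq_sum, h]
  refine Finset.sum_le_sum fun e _ => ?_
  refine (MultiGraph.graphicRank_le_card
    (Finset.univ.filter fun v => LinOrdering.pos π v ≤ level π (E.get e)) ?_).trans
    (card_filter_pos_le _ _)
  intro e' he' v hv
  have hle : level π (E.get e') ≤ level π (E.get e) :=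
    key_le_of_orderingOf_le (fun e => level π (E.get e)) he'
  simp only [Finset.mem_filter, Finset.mem_univ, true_and]
  refine le_trans ?_ hle
  rw [← rootedPos_succ, level]
  rcases hv with hv | hv
  · rw [hv]; exact le_max_left _ _
  · rw [hv]; exact le_max_right _ _

/-- The ordering of the vertices other than the root by the positions of given edges, one for each
vertex. -/
def spokeOrdering {n N : ℕ} (s : Fin n → Fin N) (σ : LinOrdering N) : LinOrdering n :=
  orderingOf fun v => σ (s v)

section Spokes

variable {n : ℕ} {E : List (Fin (n + 1) × Fin (n + 1))}
  {s : Fin n → Fin (MultiGraph.mk (n + 1) E).m} (hs : ∀ v, E.get (s v) = (0, v.succ))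
  (σ : LinOrdering (MultiGraph.mk (n + 1) E).m)

include hs

lemma incVec_spoke (v : Fin n) : (MultiGraph.mk (n + 1) E).incVec (s v) = rootVec v.succ := by
  rw [MultiGraph.incVec_eq_rootVec_add, hs, rootVec_zero, zero_add]

lemma spokeOrdering_le_iff (v w : Fin n) :
    spokeOrdering s σ v ≤ spokeOrdering s σ w ↔ σ (s v) ≤ σ (s w) := by
  refine orderingOf_le_iff (key := fun v => σ (s v)) fun v w h => ?_
  have h1 := congrArg (fun e => (E.get e).2) (σ.injective h)
  simpa only [hs, Fin.succ_inj] using h1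

/-- The prefix that ends in the spoke at `v` contains the spokes at all vertices up to `v`. -/
lemma pos_le_edgeCost_spoke (v : Fin n) :
    LinOrdering.pos (spokeOrdering s σ) v ≤ edgeCost _ σ (s v) := by
  rw [← card_filter_le]
  refine MultiGraph.card_le_graphicRank _ fun w hw => ?_
  rw [Finset.mem_filter, spokeOrdering_le_iff hs] at hw
  exact Submodule.subset_span ⟨s w, hw.2, incVec_spoke hs w⟩

/-- If every spoke costs no more than the position of its end, then every edge costs at least its
level: the edge cannot come before the spokes at the vertices that precede its later end, for
otherwise one of these spokes would be too expensive. -/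
lemma level_le_edgeCost (h : ∀ v, edgeCost _ σ (s v) ≤ LinOrdering.pos (spokeOrdering s σ) v)
    (e : Fin (MultiGraph.mk (n + 1) E).m) (he : (E.get e).1 ≠ (E.get e).2) :
    level (spokeOrdering s σ) (E.get e) ≤ edgeCost _ σ e := by
  set π := spokeOrdering s σ with hπ
  obtain ⟨x, y, hlt, hxy, hinc⟩ : ∃ x y, rootedPos π x < rootedPos π y ∧
      level π (E.get e) = rootedPos π y ∧
      (MultiGraph.mk (n + 1) E).incVec e = rootVec y + rootVec x := by
    rcases lt_trichotomy (rootedPos π (E.get e).1) (rootedPos π (E.get e).2) with h1 | h1 | h1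
    · exact ⟨_, _, h1, max_eq_right h1.le, by
        rw [MultiGraph.incVec_eq_rootVec_add]; exact add_comm _ _⟩
    · exact absurd (rootedPos_injective π h1) he
    · exact ⟨_, _, h1, max_eq_left h1.le, MultiGraph.incVec_eq_rootVec_add e⟩
  rw [hxy]
  obtain ⟨v, rfl⟩ : ∃ v : Fin n, y = v.succ := by
    induction y using Fin.cases with
    | zero => simp at hlt
    | succ v => exact ⟨v, rfl⟩
  rw [rootedPos_succ] at hlt ⊢
  have key : ∀ A : Set (Fin (MultiGraph.mk (n + 1) E).m), e ∈ A → (∀ w, π w < π v → s w ∈ A) →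
      LinOrdering.pos π v ≤ (MultiGraph.mk (n + 1) E).graphicRank A := by
    intro A heA hA
    have hw : ∀ w, π w < π v → rootVec w.succ ∈
        Submodule.span (ZMod 2) ((MultiGraph.mk (n + 1) E).incVec '' A) :=
      fun w hw => Submodule.subset_span ⟨s w, hA w hw, incVec_spoke hs w⟩
    have hx : rootVec x ∈ Submodule.span (ZMod 2) ((MultiGraph.mk (n + 1) E).incVec '' A) := by
      induction x using Fin.cases with
      | zero => rw [rootVec_zero]; exact zero_mem _
      | succ u =>
        refine hw u (Fin.lt_def.2 ?_)
        simpa [LinOrdering.pos] using hlt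
    rw [← card_filter_le]
    refine MultiGraph.card_le_graphicRank _ fun w hw' => ?_
    rcases (Finset.mem_filter.1 hw').2.lt_or_eq with h1 | h1
    · exact hw w h1
    · rw [π.injective h1, rootVec_eq_add_of_add v.succ x, ← hinc]
      exact add_mem (Submodule.subset_span ⟨e, heA, rfl⟩) hx
  by_cases hall : ∀ w, π w < π v → σ (s w) ≤ σ e
  · exact key {e' | σ e' ≤ σ e} (le_refl (σ e)) hall
  · -- The spoke at the vertex just before `v` is preceded by `e`.
    exfalso
    push Not at hall
    obtain ⟨w, hwv, hew⟩ := hall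
    have hwv' := Fin.lt_def.1 hwv
    let z : Fin n := π.symm ⟨(π v : ℕ) - 1, by omega⟩
    have hz : (π z : ℕ) = π v - 1 := by simp [z]
    have hlez : ∀ u, π u < π v → σ (s u) ≤ σ (s z) := by
      intro u hu
      rw [← spokeOrdering_le_iff hs, ← hπ, Fin.le_def, hz]
      have := Fin.lt_def.1 hu
      omega
    have h1 := key {e' | σ e' ≤ σ (s z)} (hew.le.trans (hlez w hwv)) hlez
    have h2 := h z
    rw [edgeCost] at h2
    have h3 := h1.trans h2
    rw [LinOrdering.pos, LinOrdering.pos, hz] at h3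
    omega

end Spokes

/-! ### The reduction -/

/-- The edges from the root to all other vertices. -/
def spokes (n : ℕ) : List (Fin (n + 1) × Fin (n + 1)) :=
  (List.finRange n).map fun v => (0, v.succ)

/-- The copy of an edge in the cone: a loop becomes an edge to the root. -/
def coneEdge {n : ℕ} (e : Fin n × Fin n) : Fin (n + 1) × Fin (n + 1) :=
  (if e.1 = e.2 then 0 else e.1.succ, e.2.succ)

namespace MultiGraph

/-- The number of parallel edges from the root to each vertex in the cone. It exceeds the MLVC
objective of every ordering. -/
def multiplicity (G : MultiGraph) : ℕ := G.m * G.n + 1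

/-- The edges of the cone over `G`. The copies of the spokes come first, so that the edge with
index `v < G.n` is a spoke at the vertex `v` of `G`. -/
def coneEdges (G : MultiGraph) : List (Fin (G.n + 1) × Fin (G.n + 1)) :=
  (List.replicate G.multiplicity (spokes G.n)).flatten ++ G.edges.map coneEdge

/-- The cone over `G`: a new vertex, the root, is joined to every vertex of `G` by
`G.multiplicity` parallel edges, and loops become edges to the root. The root is the vertex `0` and
the vertex `v` of `G` is renamed to `v + 1`. -/
abbrev cone (G : MultiGraph) : MultiGraph := ⟨G.n + 1, G.coneEdges⟩

/-- The contribution of the spokes to the cost of a good ordering of the edges of the cone. -/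
def shift (G : MultiGraph) : ℕ := G.multiplicity * ∑ v : Fin G.n, ((v : ℕ) + 1)

end MultiGraph

/-- Each spoke has the position of its end as its level, so the sum does not depend on `π`. -/
lemma sum_level_spokes {n : ℕ} (π : LinOrdering n) :
    ((spokes n).map (level π)).sum = ∑ v : Fin n, ((v : ℕ) + 1) := by
  rw [← sum_pos π, Fin.sum_univ_def, spokes, List.map_map]
  refine congrArg List.sum (List.map_congr_left fun v _ => ?_)
  simp [level]

lemma level_coneEdge {n : ℕ} (π : LinOrdering n) (e : Fin n × Fin n) :
    level π (coneEdge e) = max (LinOrdering.pos π e.1) (LinOrdering.pos π e.2) := by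
  unfold level coneEdge
  split_ifs with h
  · simp [h]
  · simp

lemma coneEdge_fst_ne_snd {n : ℕ} (e : Fin n × Fin n) : (coneEdge e).1 ≠ (coneEdge e).2 := by
  unfold coneEdge
  split_ifs with h
  · exact (Fin.succ_ne_zero _).symm
  · simpa using h

namespace MultiGraph

lemma sum_level_cone (G : MultiGraph) (π : LinOrdering G.n) :
    (G.coneEdges.map (level π)).sum = G.shift + mlvcCost G π := by
  rw [coneEdges, List.map_append, List.sum_append, List.map_flatten, List.map_replicate,
    List.sum_flatten, List.map_replicate, List.sum_replicate, sum_level_spokes, shift, smul_eq_mul,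
    mlvcCost, List.map_map]
  refine congrArg _ (congrArg List.sum (List.map_congr_left fun e _ => ?_))
  exact level_coneEdge π e

lemma exists_cost_le (G : MultiGraph) (π : LinOrdering G.n) :
    ∃ σ : LinOrdering G.cone.m, graphicMlopCost G.cone σ ≤ G.shift + mlvcCost G π := by
  rw [← sum_level_cone]
  exact exists_graphicMlopCost_le_sum_level _ π

end MultiGraph

lemma mlvcCost_lt_multiplicity (G : MultiGraph) (π : LinOrdering G.n) :
    mlvcCost G π < G.multiplicity := by
  refine Nat.lt_succ_of_le ?_
  have := List.sum_le_card_nsmul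
    (G.edges.map fun e => max (LinOrdering.pos π e.1) (LinOrdering.pos π e.2)) G.n (by
      intro x hx
      obtain ⟨e, -, rfl⟩ := List.mem_map.1 hx
      simp only [LinOrdering.pos]
      omega)
  simpa [mlvcCost] using this

namespace MultiGraph

lemma length_flatten_spokes (n M : ℕ) : (List.replicate M (spokes n)).flatten.length = M * n := by
  simp [spokes]

lemma m_cone (G : MultiGraph) : G.cone.m = G.multiplicity * G.n + G.m := by
  show G.coneEdges.length = _
  rw [coneEdges, List.length_append, length_flatten_spokes, List.length_map]

/-- The edges of the cone: the spokes, indexed by the copy and the vertex, and the edges of `G`. -/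
def coneEquiv (G : MultiGraph) :
    (Fin G.multiplicity × Fin G.n) ⊕ Fin G.m ≃ Fin G.cone.m :=
  (finProdFinEquiv.sumCongr (Equiv.refl _)).trans (finSumFinEquiv.trans (finCongr G.m_cone.symm))

/-- The spoke at `v` in the copy `c`. -/
def spoke (G : MultiGraph) (c : Fin G.multiplicity) (v : Fin G.n) : Fin G.cone.m :=
  G.coneEquiv (Sum.inl (c, v))

lemma spoke_val (G : MultiGraph) (c : Fin G.multiplicity) (v : Fin G.n) :
    (G.spoke c v : ℕ) = v + G.n * c := by
  simp [spoke, coneEquiv]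

lemma coneEquiv_inr_val (G : MultiGraph) (e : Fin G.m) :
    (G.coneEquiv (Sum.inr e) : ℕ) = G.multiplicity * G.n + e := by
  simp [coneEquiv]

lemma getElem?_flatten_spokes (n M c : ℕ) (hc : c < M) (v : Fin n) :
    (List.replicate M (spokes n)).flatten[(v : ℕ) + n * c]? = some (0, v.succ) := by
  induction M generalizing c with
  | zero => omega
  | succ M ih =>
    have hlen : (spokes n).length = n := by simp [spokes]
    rw [List.replicate_succ, List.flatten_cons]
    cases c with
    | zero =>
      rw [List.getElem?_append_left (by rw [hlen]; simp)]
      simp [spokes]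
    | succ c =>
      rw [List.getElem?_append_right (by rw [hlen]; nlinarith), hlen,
        show (v : ℕ) + n * (c + 1) - n = v + n * c by rw [Nat.mul_succ]; omega]
      exact ih c (by omega)

lemma get_spoke (G : MultiGraph) (c : Fin G.multiplicity) (v : Fin G.n) :
    G.coneEdges.get (G.spoke c v) = (0, v.succ) := by
  have h := getElem?_flatten_spokes G.n G.multiplicity c c.2 v
  have hlt := (List.getElem?_eq_some_iff.1 h).1
  rw [← Option.some_inj, ← h, List.get_eq_getElem, ← List.getElem?_eq_getElem, spoke_val]
  exact List.getElem?_append_left hlt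

lemma get_coneEquiv_inr (G : MultiGraph) (e : Fin G.m) :
    G.coneEdges.get (G.coneEquiv (Sum.inr e)) = coneEdge (G.edges.get e) := by
  rw [← Option.some_inj, List.get_eq_getElem, ← List.getElem?_eq_getElem, coneEquiv_inr_val,
    coneEdges, List.getElem?_append_right (by rw [length_flatten_spokes]; omega),
    length_flatten_spokes, Nat.add_sub_cancel_left]
  simp

/-- The ordering of the vertices given by the copy `c` of the spokes. -/
def copyOrdering (G : MultiGraph) (σ : LinOrdering G.cone.m) (c : Fin G.multiplicity) :
    LinOrdering G.n :=
  spokeOrdering (G.spoke c) σ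

/-- The cost of the copy `c` of the spokes. -/
noncomputable def copyCost (G : MultiGraph) (σ : LinOrdering G.cone.m) (c : Fin G.multiplicity) :
    ℕ :=
  ∑ v, edgeCost G.cone σ (G.spoke c v)

lemma graphicMlopCost_cone (G : MultiGraph) (σ : LinOrdering G.cone.m) :
    graphicMlopCost G.cone σ =
      ∑ c, G.copyCost σ c + ∑ e, edgeCost G.cone σ (G.coneEquiv (Sum.inr e)) := by
  rw [graphicMlopCost_eq_sum, ← Equiv.sum_comp G.coneEquiv, Fintype.sum_sum_type,
    Fintype.sum_prod_type]
  rfl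

lemma le_copyCost (G : MultiGraph) (σ : LinOrdering G.cone.m) (c : Fin G.multiplicity) :
    ∑ v : Fin G.n, ((v : ℕ) + 1) ≤ G.copyCost σ c := by
  rw [← sum_pos (G.copyOrdering σ c)]
  exact Finset.sum_le_sum fun v _ => pos_le_edgeCost_spoke (G.get_spoke c) σ v

/-- A copy of the spokes that has the least possible cost forces the edges of `G` to cost at least
the MLVC objective of the ordering that the copy defines. -/
lemma mlvcCost_le_of_copyCost_le (G : MultiGraph) (σ : LinOrdering G.cone.m)
    (c : Fin G.multiplicity) (h : G.copyCost σ c ≤ ∑ v : Fin G.n, ((v : ℕ) + 1)) :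
    mlvcCost G (G.copyOrdering σ c) ≤ ∑ e, edgeCost G.cone σ (G.coneEquiv (Sum.inr e)) := by
  have hle := fun v => pos_le_edgeCost_spoke (G.get_spoke c) σ v
  rw [← sum_pos (G.copyOrdering σ c)] at h
  have heq := (Finset.sum_eq_sum_iff_of_le fun v _ => hle v).1
    (le_antisymm (Finset.sum_le_sum fun v _ => hle v) h)
  rw [mlvcCost, ← Fin.sum_univ_fun_getElem]
  refine Finset.sum_le_sum fun e _ => ?_
  have he := G.get_coneEquiv_inr e
  have := level_le_edgeCost (G.get_spoke c) σ (fun v => (heq v (Finset.mem_univ v)).ge)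
    (G.coneEquiv (Sum.inr e)) (by rw [he]; exact coneEdge_fst_ne_snd _)
  rw [he, level_coneEdge] at this
  exact this

lemma shift_eq_sum (G : MultiGraph) :
    G.shift = ∑ _c : Fin G.multiplicity, ∑ v : Fin G.n, ((v : ℕ) + 1) := by
  simp [shift]

/-- If every copy of the spokes costs more than the least possible value, then the total excess is
at least the number of copies. -/
lemma shift_add_multiplicity_le (G : MultiGraph) (σ : LinOrdering G.cone.m)
    (h : ∀ c, ∑ v : Fin G.n, ((v : ℕ) + 1) < G.copyCost σ c) :
    G.shift + G.multiplicity ≤ graphicMlopCost G.cone σ := by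
  have h1 : ∑ c : Fin G.multiplicity, (∑ v : Fin G.n, ((v : ℕ) + 1) + 1) ≤ ∑ c, G.copyCost σ c :=
    Finset.sum_le_sum fun c _ => Nat.succ_le_of_lt (h c)
  rw [Finset.sum_add_distrib, ← shift_eq_sum] at h1
  rw [graphicMlopCost_cone]
  simp only [Finset.sum_const, Finset.card_univ, Fintype.card_fin, smul_eq_mul, mul_one] at h1
  omega

lemma shift_le_sum_copyCost (G : MultiGraph) (σ : LinOrdering G.cone.m) :
    G.shift ≤ ∑ c, G.copyCost σ c := by
  rw [shift_eq_sum]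
  exact Finset.sum_le_sum fun c _ => G.le_copyCost σ c

lemma exists_mlvcCost_le_iff (G : MultiGraph) (K : ℕ) :
    (∃ π : LinOrdering G.n, mlvcCost G π ≤ K) ↔
      ∃ σ : LinOrdering G.cone.m, graphicMlopCost G.cone σ ≤ K + G.shift := by
  constructor
  · rintro ⟨π, hπ⟩
    obtain ⟨σ, hσ⟩ := G.exists_cost_le π
    exact ⟨σ, by omega⟩
  · rintro ⟨σ, hσ⟩
    by_cases h : ∀ c, ∑ v : Fin G.n, ((v : ℕ) + 1) < G.copyCost σ c
    · -- Here `K` is so large that every ordering will do.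
      have h1 := G.shift_add_multiplicity_le σ h
      have h2 := mlvcCost_lt_multiplicity G (Equiv.refl _)
      exact ⟨Equiv.refl _, by omega⟩
    · push Not at h
      obtain ⟨c, hc⟩ := h
      have h1 := G.mlvcCost_le_of_copyCost_le σ c hc
      have h2 := G.shift_le_sum_copyCost σ
      rw [graphicMlopCost_cone] at hσ
      exact ⟨_, h1.trans (by omega)⟩

/-- In an optimal ordering of the edges of the cone every copy of the spokes has the least possible
cost, so that each copy defines an optimal ordering of the vertices. -/
lemma isOptimal_copyOrdering (G : MultiGraph) (σ : LinOrdering G.cone.m)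
    (hσ : IsOptimal (graphicMlopCost G.cone) σ) (c : Fin G.multiplicity) :
    IsOptimal (mlvcCost G) (G.copyOrdering σ c) := by
  have hup : ∀ π, graphicMlopCost G.cone σ ≤ G.shift + mlvcCost G π := by
    intro π
    obtain ⟨τ, hτ⟩ := G.exists_cost_le π
    exact (hσ τ).trans hτ
  obtain ⟨b, hb⟩ : ∃ b, G.copyCost σ b ≤ ∑ v : Fin G.n, ((v : ℕ) + 1) := by
    by_contra! h
    have h1 := G.shift_add_multiplicity_le σ h
    have h2 := mlvcCost_lt_multiplicity G (Equiv.refl _)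
    have h3 := hup (Equiv.refl _)
    omega
  have hsum : ∑ b, G.copyCost σ b ≤ G.shift := by
    have h1 := G.mlvcCost_le_of_copyCost_le σ b hb
    have h2 := hup (G.copyOrdering σ b)
    rw [graphicMlopCost_cone] at h2
    omega
  rw [shift_eq_sum] at hsum
  have heq := (Finset.sum_eq_sum_iff_of_le fun b _ => G.le_copyCost σ b).1
    (le_antisymm (Finset.sum_le_sum fun b _ => G.le_copyCost σ b) hsum)
  intro π
  have h1 := G.mlvcCost_le_of_copyCost_le σ c (heq c (Finset.mem_univ c)).ge
  have h2 := hup π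
  have h3 := G.shift_le_sum_copyCost σ
  rw [graphicMlopCost_cone] at h2
  omega

/-- The vertex ordering read off from an edge ordering of the cone: the order of the spokes in the
copy `0`, whose indices are `0, …, n - 1`. -/
def pullback (G : MultiGraph) (σ : LinOrdering G.cone.m) : LinOrdering G.n :=
  G.copyOrdering σ ⟨0, Nat.succ_pos _⟩

/-- Listing the vertices in the order `G.pullback σ` amounts to deleting all numbers that are not
less than `n` from the list of the edges in the order `σ`. -/
lemma map_finRange_pullback (G : MultiGraph) (σ : LinOrdering G.cone.m) :
    ((List.finRange G.n).map fun i => ((G.pullback σ).symm i : ℕ)) =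
      ((List.finRange G.cone.m).map fun i => (σ.symm i : ℕ)).filter (· < G.n) := by
  set z : Fin G.multiplicity := ⟨0, Nat.succ_pos _⟩
  have hz : ∀ v, (G.spoke z v : ℕ) = v := fun v => by rw [spoke_val]; simp [z]
  have hinj : ∀ {N : ℕ} (τ : LinOrdering N), Function.Injective fun i => (τ.symm i : ℕ) :=
    fun τ i j h => τ.symm.injective (Fin.ext h)
  -- Both lists are permutations of the numbers less than `n` that are sorted by the position of the
  -- spoke in the copy `0`.
  refine List.Perm.eq_of_pairwise (le := fun a b : ℕ => ∃ v w : Fin G.n, a = v ∧ b = w ∧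
    σ (G.spoke z v) < σ (G.spoke z w)) ?_ ?_ ?_ ?_
  · rintro a b - - ⟨v, w, hv, hw, h⟩ ⟨v', w', hv', hw', h'⟩
    have h1 : v = w' := Fin.ext (hv.symm.trans hw')
    have h2 : w = v' := Fin.ext (hw.symm.trans hv')
    subst h1 h2
    exact absurd h h'.asymm
  · rw [List.pairwise_map]
    refine (List.pairwise_lt_finRange _).imp fun {i j} hij => ?_
    refine ⟨_, _, rfl, rfl, lt_of_not_ge fun h => ?_⟩
    rw [← spokeOrdering_le_iff (G.get_spoke z) σ] at h
    have h2 : G.pullback σ ((G.pullback σ).symm j) ≤ G.pullback σ ((G.pullback σ).symm i) := h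
    simp only [Equiv.apply_symm_apply] at h2
    exact absurd hij (not_lt.2 h2)
  · rw [List.pairwise_filter, List.pairwise_map]
    refine (List.pairwise_lt_finRange _).imp fun {i j} hij hi hj => ?_
    simp only [decide_eq_true_eq] at hi hj
    refine ⟨⟨_, hi⟩, ⟨_, hj⟩, rfl, rfl, ?_⟩
    have hi' : G.spoke z ⟨_, hi⟩ = σ.symm i := Fin.ext (hz _)
    have hj' : G.spoke z ⟨_, hj⟩ = σ.symm j := Fin.ext (hz _)
    rw [hi', hj']
    simpa using hij
  · rw [List.perm_ext_iff_of_nodup ((List.nodup_finRange _).map (hinj _))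
      (((List.nodup_finRange _).map (hinj _)).filter _)]
    intro a
    simp only [List.mem_map, List.mem_finRange, true_and, List.mem_filter, decide_eq_true_eq]
    constructor
    · rintro ⟨i, rfl⟩
      exact ⟨⟨σ (G.spoke z ((G.pullback σ).symm i)), by simp [hz]⟩, Fin.is_lt _⟩
    · rintro ⟨-, h⟩
      exact ⟨G.pullback σ ⟨a, h⟩, by simp⟩

end MultiGraph

/-! ### Structured programs on stacks -/

namespace StackProgram

open Turing

/-- Structured programs working on stacks `k : K` with alphabets `Γ k`. -/
inductive Cmd {K : Type} (Γ : K → Type) : Type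
  /-- do nothing -/
  | skip : Cmd Γ
  /-- push a symbol -/
  | push (k : K) (a : Γ k) : Cmd Γ
  /-- execute two programs one after the other -/
  | seq (c₁ c₂ : Cmd Γ) : Cmd Γ
  /-- pop a symbol (`none` if the stack is empty), execute the corresponding branch of `body`, and
  repeat if `cont` holds for that symbol -/
  | loop (k : K) (cont : Option (Γ k) → Bool) (body : Option (Γ k) → Cmd Γ) : Cmd Γ

namespace Cmd

variable {K : Type} {Γ : K → Type}

/-- The program points of a program. -/
def Label : Cmd Γ → Type
  | skip => Unit
  | push _ _ => Unit
  | seq c₁ c₂ => c₁.Label ⊕ c₂.Label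
  | loop k _ body => Option (Σ a : Option (Γ k), (body a).Label)

/-- A program has finitely many program points. -/
@[reducible] noncomputable def fintypeLabel [∀ k, Fintype (Γ k)] : ∀ c : Cmd Γ, Fintype c.Label
  | skip => inferInstanceAs (Fintype Unit)
  | push _ _ => inferInstanceAs (Fintype Unit)
  | seq c₁ c₂ =>
    letI := c₁.fintypeLabel
    letI := c₂.fintypeLabel
    inferInstanceAs (Fintype (c₁.Label ⊕ c₂.Label))
  | loop k _ body =>
    letI := fun a => (body a).fintypeLabel
    inferInstanceAs (Fintype (Option (Σ a : Option (Γ k), (body a).Label)))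

/-- The program point at which the execution starts. -/
def entry : ∀ c : Cmd Γ, c.Label
  | skip => ()
  | push _ _ => ()
  | seq c₁ _ => Sum.inl c₁.entry
  | loop _ _ _ => none

variable [DecidableEq K]

/-- The TM2 statements of a program whose program points are named by `ι`, and which goes to the
label `exit` at the end. The internal state of the machine holds, for each stack, the symbol that
was popped last. -/
def stmt {Λ : Type} : ∀ c : Cmd Γ, (c.Label → Λ) → Λ → c.Label →
    TM2.Stmt Γ Λ (∀ k, Option (Γ k))
  | skip, _, exit, _ => .goto fun _ => exit
  | push k a, _, exit, _ => .push k (fun _ => a) (.goto fun _ => exit)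
  | seq c₁ c₂, ι, _, Sum.inl l => c₁.stmt (fun l => ι (Sum.inl l)) (ι (Sum.inr c₂.entry)) l
  | seq _ c₂, ι, exit, Sum.inr l => c₂.stmt (fun l => ι (Sum.inr l)) exit l
  | loop k _ body, ι, _, none =>
    .pop k (fun v a => Function.update v k a)
      (.goto fun v => ι (some ⟨v k, (body (v k)).entry⟩))
  | loop _ cont body, ι, exit, some ⟨a, l⟩ =>
    (body a).stmt (fun l => ι (some ⟨a, l⟩)) (if cont a then ι none else exit) l

/-- `Exec c S S' t`: the program `c` transforms the stacks `S` into `S'` in time `t`. -/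
inductive Exec : Cmd Γ → (∀ k, List (Γ k)) → (∀ k, List (Γ k)) → ℕ → Prop
  | skip (S) : Exec skip S S 1
  | push (k a S) : Exec (push k a) S (Function.update S k (a :: S k)) 1
  | seq {c₁ c₂ S S₁ S₂ t₁ t₂} : Exec c₁ S S₁ t₁ → Exec c₂ S₁ S₂ t₂ →
      Exec (seq c₁ c₂) S S₂ (t₁ + t₂)
  | last {k cont body S S' t} : cont (S k).head? = false →
      Exec (body (S k).head?) (Function.update S k (S k).tail) S' t →
      Exec (loop k cont body) S S' (1 + t)
  | again {k cont body S S₁ S₂ t₁ t₂} : cont (S k).head? = true →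
      Exec (body (S k).head?) (Function.update S k (S k).tail) S₁ t₁ →
      Exec (loop k cont body) S₁ S₂ t₂ → Exec (loop k cont body) S S₂ (1 + t₁ + t₂)

/-- The TM2 statements of a program simulate its execution step by step. -/
lemma Exec.iterate_step {c : Cmd Γ} {S S' : ∀ k, List (Γ k)} {t : ℕ} (h : Exec c S S' t)
    {Λ : Type} (M : Λ → TM2.Stmt Γ Λ (∀ k, Option (Γ k))) (ι : c.Label → Λ) (exit : Λ)
    (hM : ∀ l, M (ι l) = c.stmt ι exit l) (v : ∀ k, Option (Γ k)) :
    ∃ v', (flip bind (TM2.step M))^[t] (some ⟨some (ι c.entry), v, S⟩) =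
      some ⟨some exit, v', S'⟩ := by
  have hpop : ∀ {k cont body S} (ι : (loop k cont body).Label → Λ) (exit : Λ),
      (∀ l, M (ι l) = (loop k cont body).stmt ι exit l) → ∀ v,
      (flip bind (TM2.step M))^[1] (some ⟨some (ι (loop k cont body).entry), v, S⟩) =
        some ⟨some (ι (some ⟨(S k).head?, (body (S k).head?).entry⟩)),
          Function.update v k (S k).head?, Function.update S k (S k).tail⟩ := by
    intro k cont body S ι exit hM v
    show TM2.step M ⟨some (ι none), v, S⟩ = _
    rw [TM2.step, hM none]
    exact congrArg (fun a => some (⟨some (ι (some ⟨a, (body a).entry⟩)),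
      Function.update v k (S k).head?, Function.update S k (S k).tail⟩ : TM2.Cfg Γ Λ _))
      (Function.update_self k (S k).head? v)
  induction h generalizing v exit with
  | skip S =>
    refine ⟨v, ?_⟩
    show TM2.step M ⟨some (ι ()), v, S⟩ = _
    rw [TM2.step, hM ()]
    rfl
  | push k a S =>
    refine ⟨v, ?_⟩
    show TM2.step M ⟨some (ι ()), v, S⟩ = _
    rw [TM2.step, hM ()]
    rfl
  | seq h₁ h₂ ih₁ ih₂ =>
    obtain ⟨v₁, hv₁⟩ := ih₁ (fun l => ι (Sum.inl l)) (ι (Sum.inr (entry _)))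
      (fun l => hM (Sum.inl l)) v
    obtain ⟨v₂, hv₂⟩ := ih₂ (fun l => ι (Sum.inr l)) exit (fun l => hM (Sum.inr l)) v₁
    refine ⟨v₂, ?_⟩
    rw [add_comm, Function.iterate_add_apply, entry, hv₁, hv₂]
  | @last k cont body S S' t hc h ih =>
    obtain ⟨v₁, hv₁⟩ := ih (fun l => ι (some ⟨_, l⟩)) exit
      (fun l => by rw [hM (some ⟨_, l⟩), stmt, hc]; rfl) (Function.update v k (S k).head?)
    refine ⟨v₁, ?_⟩
    rw [add_comm, Function.iterate_add_apply, hpop ι exit hM, hv₁]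
  | @again k cont body S S₁ S₂ t₁ t₂ hc h₁ h₂ ih₁ ih₂ =>
    obtain ⟨v₁, hv₁⟩ := ih₁ (fun l => ι (some ⟨_, l⟩)) (ι none)
      (fun l => by rw [hM (some ⟨_, l⟩), stmt, hc]; rfl) (Function.update v k (S k).head?)
    obtain ⟨v₂, hv₂⟩ := ih₂ ι exit hM v₁
    refine ⟨v₂, ?_⟩
    rw [add_comm, Function.iterate_add_apply, add_comm 1, Function.iterate_add_apply _ t₁ 1,
      hpop ι exit hM, hv₁]
    exact hv₂

/-- The machine that executes a program, resets its internal state and halts. -/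
noncomputable def machine [Fintype K] [∀ k, Fintype (Γ k)] (c : Cmd Γ) (k₀ k₁ : K) : FinTM2 where
  K := K
  k₀ := k₀
  k₁ := k₁
  Γ := Γ
  Λ := Option c.Label
  main := some c.entry
  ΛFin := letI := c.fintypeLabel; inferInstance
  σ := ∀ k, Option (Γ k)
  initialState := fun _ => none
  m
    | none => .load (fun _ _ => none) .halt
    | some l => c.stmt some none l

end Cmd

open Cmd

/-- `initList` in terms of `Function.update`. -/
lemma initList_eq (tm : FinTM2) (l : List (tm.Γ tm.k₀)) :
    initList tm l = ⟨some tm.main, tm.initialState, Function.update (fun _ => []) tm.k₀ l⟩ := by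
  unfold initList
  congr 1
  funext k
  by_cases hk : k = tm.k₀
  · subst hk
    rw [Function.update_self]
    exact dif_pos rfl
  · rw [Function.update_of_ne hk]
    exact dif_neg hk

/-- `haltList` in terms of `Function.update`. -/
lemma haltList_eq (tm : FinTM2) (l : List (tm.Γ tm.k₁)) :
    haltList tm l = ⟨none, tm.initialState, Function.update (fun _ => []) tm.k₁ l⟩ := by
  unfold haltList
  congr 1
  funext k
  by_cases hk : k = tm.k₁
  · subst hk
    rw [Function.update_self]
    exact dif_pos rfl
  · rw [Function.update_of_ne hk]
    exact dif_neg hk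

/-- A program that runs in polynomial time on all inputs defines a polynomial-time computable
function. -/
theorem polyTimeComputable_of_exec {K : Type} {Γ : K → Type} [DecidableEq K] [Fintype K]
    [∀ k, Fintype (Γ k)] (k₀ k₁ : K) {α β : Type} (ea : α → List (Γ k₀)) (eb : β → List (Γ k₁))
    (f : α → β) (c : Cmd Γ) (p : Polynomial ℕ)
    (h : ∀ a, ∃ t ≤ p.eval (ea a).length,
      Exec c (Function.update (fun _ => []) k₀ (ea a)) (Function.update (fun _ => []) k₁ (eb (f a)))
        t) :
    PolyTimeComputable ea eb f := by
  refine ⟨⟨⟨c.machine k₀ k₁, Equiv.refl _, Equiv.refl _⟩, p + 1, fun a => Nonempty.some ?_⟩⟩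
  obtain ⟨t, ht, hexec⟩ := h a
  obtain ⟨v, hv⟩ := hexec.iterate_step (c.machine k₀ k₁).m some none (fun _ => rfl) fun _ => none
  have hinit : initList (c.machine k₀ k₁) (ea a) =
      ⟨some (some c.entry), fun _ => none, Function.update (fun _ => []) k₀ (ea a)⟩ :=
    initList_eq _ _
  have hhalt : haltList (c.machine k₀ k₁) (eb (f a)) =
      ⟨none, fun _ => none, Function.update (fun _ => []) k₁ (eb (f a))⟩ :=
    haltList_eq _ _
  have key : (flip bind (c.machine k₀ k₁).step)^[t + 1]
      (some (initList (c.machine k₀ k₁) (ea a))) = some (haltList (c.machine k₀ k₁) (eb (f a))) := by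
    rw [hinit, hhalt, add_comm, Function.iterate_add_apply]
    exact (congrArg _ hv).trans rfl
  refine ⟨⟨t + 1, ?_⟩, by simpa using ht⟩
  exact (congrArg (fun l => (flip bind (c.machine k₀ k₁).step)^[t + 1]
    (some (initList (c.machine k₀ k₁) l))) (List.map_id _)).trans
    (key.trans (congrArg (fun l => some (haltList (c.machine k₀ k₁) l)) (List.map_id _).symm))

/-! ### Programs on a fixed set of stacks -/

/-- The stacks of the machines below. -/
inductive Stk
  /-- the input -/
  | inp
  /-- the output -/
  | out
  /-- the part of the input that encodes a multigraph -/
  | src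
  /-- the other part of the input: a threshold or an ordering -/
  | num
  /-- the first part of the encoded output, reversed -/
  | rev
  /-- the second part of the encoded output, reversed -/
  | tail
  /-- a unary counter for the shift of the threshold -/
  | cnt
  /-- the encoded spokes -/
  | spk
  /-- auxiliary storage -/
  | tmp
  /-- unary counters -/
  | n | p | u | v | u' | v'
  deriving DecidableEq

instance : Fintype Stk where
  elems := {.inp, .out, .src, .num, .rev, .tail, .cnt, .spk, .tmp, .n, .p, .u, .v, .u', .v'}
  complete k := by cases k <;> decide

/-- The alphabets of the stacks: `α` for the input, `β` for the output, bits for the others. -/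
@[reducible] def Alph (α β : Type) : Stk → Type
  | .inp => α
  | .out => β
  | _ => Bool

instance {α β : Type} [Fintype α] [Fintype β] (k : Stk) : Fintype (Alph α β k) := by
  cases k <;> infer_instance

/-- The contents of all stacks. -/
structure Mem (α β : Type) where
  /-- the contents of the stack `Stk.inp` -/
  inp : List α := []
  /-- the contents of the stack `Stk.out` -/
  out : List β := []
  /-- the contents of the stack `Stk.src` -/
  src : List Bool := []
  /-- the contents of the stack `Stk.num` -/
  num : List Bool := []
  /-- the contents of the stack `Stk.rev` -/
  rev : List Bool := []
  /-- the contents of the stack `Stk.tail` -/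
  tail : List Bool := []
  /-- the contents of the stack `Stk.cnt` -/
  cnt : List Bool := []
  /-- the contents of the stack `Stk.spk` -/
  spk : List Bool := []
  /-- the contents of the stack `Stk.tmp` -/
  tmp : List Bool := []
  /-- the contents of the stack `Stk.n` -/
  n : List Bool := []
  /-- the contents of the stack `Stk.p` -/
  p : List Bool := []
  /-- the contents of the stack `Stk.u` -/
  u : List Bool := []
  /-- the contents of the stack `Stk.v` -/
  v : List Bool := []
  /-- the contents of the stack `Stk.u'` -/
  u' : List Bool := []
  /-- the contents of the stack `Stk.v'` -/
  v' : List Bool := []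

variable {α β : Type}

/-- The contents of a stack. -/
def Mem.get (M : Mem α β) : ∀ k, List (Alph α β k)
  | .inp => M.inp
  | .out => M.out
  | .src => M.src
  | .num => M.num
  | .rev => M.rev
  | .tail => M.tail
  | .cnt => M.cnt
  | .spk => M.spk
  | .tmp => M.tmp
  | .n => M.n
  | .p => M.p
  | .u => M.u
  | .v => M.v
  | .u' => M.u'
  | .v' => M.v'

/-- Replace the contents of a stack. -/
def Mem.set (M : Mem α β) : ∀ k, List (Alph α β k) → Mem α β
  | .inp, l => { M with inp := l }
  | .out, l => { M with out := l }
  | .src, l => { M with src := l }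
  | .num, l => { M with num := l }
  | .rev, l => { M with rev := l }
  | .tail, l => { M with tail := l }
  | .cnt, l => { M with cnt := l }
  | .spk, l => { M with spk := l }
  | .tmp, l => { M with tmp := l }
  | .n, l => { M with n := l }
  | .p, l => { M with p := l }
  | .u, l => { M with u := l }
  | .v, l => { M with v := l }
  | .u', l => { M with u' := l }
  | .v', l => { M with v' := l }

lemma Mem.update_get (M : Mem α β) (k : Stk) (l : List (Alph α β k)) :
    Function.update M.get k l = (M.set k l).get := by
  funext k'
  by_cases h : k' = k
  · subst h
    rw [Function.update_self]
    cases k' <;> rfl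
  · rw [Function.update_of_ne h]
    cases k <;> cases k' <;> first | exact absurd rfl h | rfl

lemma Mem.get_set_self (M : Mem α β) (k : Stk) (l : List (Alph α β k)) :
    (M.set k l).get k = l := by
  cases k <;> rfl

lemma Mem.set_set (M : Mem α β) (k : Stk) (l l' : List (Alph α β k)) :
    (M.set k l).set k l' = M.set k l' := by
  cases k <;> rfl

lemma Mem.set_get (M : Mem α β) (k : Stk) : M.set k (M.get k) = M := by
  cases k <;> rfl

/-- `Does c M M' b`: the program `c` transforms the memory `M` into `M'` in time at most `b`. -/
def Does (c : Cmd (Alph α β)) (M M' : Mem α β) (b : ℕ) : Prop :=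
  ∃ t ≤ b, Exec c M.get M'.get t

namespace Does

variable {c c₁ c₂ : Cmd (Alph α β)} {M M₁ M₂ : Mem α β} {b b₁ b₂ : ℕ} {k : Stk}

lemma mono (h : Does c M M₁ b₁) (hb : b₁ ≤ b₂) : Does c M M₁ b₂ :=
  let ⟨t, ht, he⟩ := h
  ⟨t, ht.trans hb, he⟩

lemma of_eq (h : Does c M M₁ b₁) (hM : M₁ = M₂) : Does c M M₂ b₁ := hM ▸ h

lemma skip (M : Mem α β) : Does .skip M M 1 := ⟨1, le_rfl, .skip _⟩

lemma push (k : Stk) (a : Alph α β k) (M : Mem α β) :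
    Does (.push k a) M (M.set k (a :: M.get k)) 1 :=
  ⟨1, le_rfl, M.update_get k _ ▸ .push k a _⟩

lemma seq (h₁ : Does c₁ M M₁ b₁) (h₂ : Does c₂ M₁ M₂ b₂) : Does (.seq c₁ c₂) M M₂ (b₁ + b₂) :=
  let ⟨t₁, ht₁, he₁⟩ := h₁
  let ⟨t₂, ht₂, he₂⟩ := h₂
  ⟨t₁ + t₂, add_le_add ht₁ ht₂, .seq he₁ he₂⟩

variable {cont : Option (Alph α β k) → Bool} {body : Option (Alph α β k) → Cmd (Alph α β)}

lemma loop_nil (hk : M.get k = []) (hc : cont none = false) (h : Does (body none) M M₁ b) :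
    Does (.loop k cont body) M M₁ (b + 1) := by
  obtain ⟨t, ht, he⟩ := h
  refine ⟨1 + t, by omega, .last (by rw [hk]; exact hc) ?_⟩
  rw [M.update_get, hk]
  have := M.set_get k
  rw [hk] at this
  exact this.symm ▸ he

lemma loop_stop {a : Alph α β k} {l : List (Alph α β k)} (hk : M.get k = a :: l)
    (hc : cont (some a) = false) (h : Does (body (some a)) (M.set k l) M₁ b) :
    Does (.loop k cont body) M M₁ (b + 1) := by
  obtain ⟨t, ht, he⟩ := h
  refine ⟨1 + t, by omega, .last (by rw [hk]; exact hc) ?_⟩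
  rw [M.update_get, hk]
  exact he

lemma loop_cont {a : Alph α β k} {l : List (Alph α β k)} (hk : M.get k = a :: l)
    (hc : cont (some a) = true) (h₁ : Does (body (some a)) (M.set k l) M₁ b₁)
    (h₂ : Does (.loop k cont body) M₁ M₂ b₂) :
    Does (.loop k cont body) M M₂ (b₁ + 1 + b₂) := by
  obtain ⟨t₁, ht₁, he₁⟩ := h₁
  obtain ⟨t₂, ht₂, he₂⟩ := h₂
  refine ⟨1 + t₁ + t₂, by omega, .again (by rw [hk]; exact hc) ?_ he₂⟩
  rw [M.update_get, hk]
  exact he₁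

end Does

/-- Pop all symbols of a stack and execute a program for each of them. -/
def each (k : Stk) (body : Alph α β k → Cmd (Alph α β)) : Cmd (Alph α β) :=
  .loop k Option.isSome fun o => o.elim .skip body

/-- Pop a symbol and execute the corresponding program. -/
def popCase (k : Stk) (body : Option (Alph α β k) → Cmd (Alph α β)) : Cmd (Alph α β) :=
  .loop k (fun _ => false) body

/-- Read a unary number from `Stk.src` up to its final `false`, and execute a program for each
`true`. -/
def readUnary (c : Cmd (Alph α β)) : Cmd (Alph α β) :=
  .loop .src (· == some true) fun o => if o = some true then c else .skip

lemma Does.each_nil {k : Stk} {body : Alph α β k → Cmd (Alph α β)} {M : Mem α β}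
    (hk : M.get k = []) : Does (each k body) M M 2 :=
  Does.loop_nil hk rfl (Does.skip M)

lemma Does.each_cons {k : Stk} {body : Alph α β k → Cmd (Alph α β)} {M M₁ M₂ : Mem α β}
    {b₁ b₂ : ℕ} {a : Alph α β k} {l : List (Alph α β k)} (hk : M.get k = a :: l)
    (h₁ : Does (body a) (M.set k l) M₁ b₁) (h₂ : Does (each k body) M₁ M₂ b₂) :
    Does (each k body) M M₂ (b₁ + 1 + b₂) :=
  Does.loop_cont hk rfl h₁ h₂

/-- If the body of a loop over the stack `k` acts as `f`, which does not touch this stack, then the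
loop acts as the iteration of `f` over the contents of the stack. The predicate `I` is an
invariant. -/
lemma Does.each_foldl {k : Stk} {body : Alph α β k → Cmd (Alph α β)}
    (f : Mem α β → Alph α β k → Mem α β) (I : Mem α β → Prop) (b : ℕ)
    (hset : ∀ M a l, (f M a).set k l = f (M.set k l) a)
    (hIset : ∀ M l, I M → I (M.set k l)) (hI : ∀ M a, I M → I (f M a))
    (h : ∀ M a, I M → Does (body a) M (f M a) b) (M : Mem α β) (hM : I M) :
    Does (each k body) M ((M.get k).foldl f (M.set k [])) ((b + 1) * (M.get k).length + 2) := by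
  induction hl : M.get k generalizing M with
  | nil =>
    refine ((Does.each_nil hl).of_eq ?_).mono (by omega)
    rw [← hl, M.set_get, hl, List.foldl_nil]
  | cons a l ih =>
    have h0 : (f (M.set k l) a).get k = l := by
      rw [← Mem.set_set M k [] l, ← hset, Mem.get_set_self]
    have h1 := ih (f (M.set k l) a) (hI _ _ (hIset _ _ hM)) h0
    rw [hset, Mem.set_set] at h1
    refine (Does.each_cons hl (h _ _ (hIset _ _ hM)) h1).mono ?_
    rw [List.length_cons]
    ring_nf
    omega

/-- A variant of `Does.each_foldl` where the iteration of `f` is given in closed form as `g`. -/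
lemma Does.each_of_body {k : Stk} {body : Alph α β k → Cmd (Alph α β)}
    (f : Mem α β → Alph α β k → Mem α β) (g : List (Alph α β k) → Mem α β → Mem α β) (b : ℕ)
    (hset : ∀ M a l, (f M a).set k l = f (M.set k l) a)
    (hnil : ∀ M, g [] M = M) (hcons : ∀ a l M, g l (f M a) = g (a :: l) M)
    (h : ∀ M a, Does (body a) M (f M a) b) (M : Mem α β) :
    Does (each k body) M (g (M.get k) (M.set k [])) ((b + 1) * (M.get k).length + 2) := by
  refine (Does.each_foldl f (fun _ => True) b hset (fun _ _ _ => trivial) (fun _ _ _ => trivial)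
    (fun M a _ => h M a) M trivial).of_eq ?_
  generalize M.get k = l
  generalize M.set k [] = M
  induction l generalizing M with
  | nil => exact (hnil M).symm
  | cons a l ih => rw [List.foldl_cons, ih, hcons]

/-- If a program acts as `f`, which neither depends on `Stk.src` nor touches it, then executing it
for a unary number in `Stk.src` iterates `f`. -/
lemma Does.readUnary_iterate {c : Cmd (Alph α β)} (f : Mem α β → Mem α β) (b : ℕ)
    (hset : ∀ M l, { f M with src := l } = f { M with src := l })
    (h : ∀ M, Does c M (f M) b) (j : ℕ) (l : List Bool) (M : Mem α β)
    (hM : M.src = List.replicate j true ++ false :: l) :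
    Does (readUnary c) M (f^[j] { M with src := l }) ((b + 1) * j + 2) := by
  induction j generalizing M with
  | zero =>
    exact (Does.loop_stop (k := .src) (a := false) (l := l) hM rfl (Does.skip _)).mono (by omega)
  | succ j ih =>
    have h0 : (f { M with src := List.replicate j true ++ false :: l }).src =
        List.replicate j true ++ false :: l :=
      congrArg Mem.src (hset M (List.replicate j true ++ false :: l)).symm
    have h1 := ih _ h0
    rw [hset] at h1
    refine (Does.loop_cont (k := .src) (a := true) (l := List.replicate j true ++ false :: l)
      hM rfl (h _) h1).mono ?_
    ring_nf
    omega

/-- Empty a stack. -/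
def clear (k : Stk) : Cmd (Alph α β) := each k fun _ => .skip

lemma does_clear (k : Stk) (M : Mem α β) :
    Does (clear k) M (M.set k []) (2 * (M.get k).length + 2) := by
  exact Does.each_of_body (fun M _ => M) (fun _ M => M) 1 (fun _ _ _ => rfl) (fun _ => rfl)
    (fun _ _ _ => rfl) (fun M _ => Does.skip M) M

infixr:60 " ;; " => Cmd.seq

lemma replicate_append_cons {A : Type} (k : ℕ) (a : A) (l : List A) :
    List.replicate k a ++ a :: l = a :: (List.replicate k a ++ l) := by
  induction k with
  | zero => rfl
  | succ k ih => rw [List.replicate_succ, List.cons_append, ih, List.cons_append]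

/-! ### Programs for the cone -/

/-- The bit string that encodes the list of the spokes. -/
def spokeBits : ℕ → List Bool
  | 0 => []
  | k + 1 => spokeBits k ++ false :: (List.replicate (k + 1) true ++ [false])

/-- Write the encoding of the spokes to `Stk.spk`; the number of vertices is taken from `Stk.n`. -/
def buildSpokes : Cmd (Alph α β) :=
  each .n fun _ => .push .spk false ;; .push .spk true ;;
    each .n (fun _ => .push .u true ;; .push .spk true) ;;
    each .u (fun _ => .push .n true) ;; .push .spk false

lemma does_buildSpokes (k : ℕ) (M : Mem α β) (hn : M.n = List.replicate k true) (hu : M.u = []) :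
    Does buildSpokes M { M with n := [], spk := spokeBits k ++ M.spk } ((5 * k + 10) * k + 2) := by
  induction k generalizing M with
  | zero =>
    exact ((Does.each_nil (k := .n) hn).of_eq (by cases M; simp_all [spokeBits])).mono (by omega)
  | succ k ih =>
    let M₁ : Mem α β := { M with n := List.replicate k true, spk := true :: false :: M.spk }
    let M₂ : Mem α β := { M with
      n := [], u := List.replicate k true, spk := List.replicate (k + 1) true ++ false :: M.spk }
    let M₃ : Mem α β := { M with
      n := List.replicate k true, spk := List.replicate (k + 1) true ++ false :: M.spk }
    have h₂ : Does (each .n fun _ => .push .u true ;; .push .spk true) M₁ M₂ (3 * k + 2) := by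
      refine ((Does.each_of_body (fun M _ => { M with u := true :: M.u, spk := true :: M.spk })
        (fun l M => { M with
          u := List.replicate l.length true ++ M.u
          spk := List.replicate l.length true ++ M.spk }) 2
        (fun _ _ _ => rfl) (fun _ => rfl)
        (fun a l M => by simp [List.replicate_succ, replicate_append_cons])
        (fun M _ => (Does.push .u true M).seq (Does.push .spk true _)) M₁).of_eq ?_).mono
          (by simp [M₁, Mem.get])
      simp [M₁, M₂, Mem.get, Mem.set, hu, List.replicate_succ, replicate_append_cons]
    have h₃ : Does (each .u fun _ => .push .n true) M₂ M₃ (2 * k + 2) := by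
      refine ((Does.each_of_body (fun M _ => { M with n := true :: M.n })
        (fun l M => { M with n := List.replicate l.length true ++ M.n }) 1
        (fun _ _ _ => rfl) (fun _ => rfl)
        (fun a l M => by simp [List.replicate_succ, replicate_append_cons])
        (fun M _ => Does.push .n true M) M₂).of_eq ?_).mono (by simp [M₂, Mem.get])
      simp [M₂, M₃, Mem.get, Mem.set, hu]
    have h₄ := ih { M₃ with spk := false :: M₃.spk } rfl hu
    refine ((Does.each_cons (k := .n) (a := true) (l := List.replicate k true) hn
      ((Does.push .spk false _).seq ((Does.push .spk true _).seq
        (h₂.seq (h₃.seq (Does.push .spk false _))))) h₄).of_eq ?_).mono ?_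
    · simp [M₃, spokeBits]
    · ring_nf
      omega

/-- Append the encoding of the spokes to the output in `Stk.rev` and count its ones in
`Stk.cnt`. -/
def copySpokes : Cmd (Alph α β) :=
  each .spk (fun b => .push .tmp b ;; .push .rev b ;; if b then .push .cnt true else .skip) ;;
    each .tmp fun b => .push .spk b

lemma does_copySpokes (M : Mem α β) (ht : M.tmp = []) :
    Does copySpokes M { M with
      rev := M.spk.reverse ++ M.rev
      cnt := List.replicate (M.spk.count true) true ++ M.cnt } (6 * M.spk.length + 4) := by
  have h₁ : Does (each .spk fun b => .push .tmp b ;; .push .rev b ;;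
        if b then .push .cnt true else .skip) M { M with
      spk := []
      tmp := M.spk.reverse
      rev := M.spk.reverse ++ M.rev
      cnt := List.replicate (M.spk.count true) true ++ M.cnt } (4 * M.spk.length + 2) := by
    refine (Does.each_of_body (k := .spk) (fun M b => { M with
      tmp := b :: M.tmp
      rev := b :: M.rev
      cnt := if b then true :: M.cnt else M.cnt })
      (fun l M => { M with
        tmp := l.reverse ++ M.tmp
        rev := l.reverse ++ M.rev
        cnt := List.replicate (l.count true) true ++ M.cnt }) 3
      (fun _ _ _ => rfl) (fun _ => rfl) (fun b l M => ?_) (fun M b => ?_) M).of_eq ?_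
    · cases b <;> simp [List.replicate_succ, replicate_append_cons]
    · refine (Does.push .tmp b M).seq ((Does.push .rev b _).seq (b₂ := 1) ?_)
      cases b
      · exact Does.skip _
      · exact Does.push .cnt true _
    · simp [Mem.get, Mem.set, ht]
  refine ((h₁.seq (Does.each_of_body (k := .tmp) (fun M b => { M with spk := b :: M.spk })
    (fun l M => { M with spk := l.reverse ++ M.spk }) 1
    (fun _ _ _ => rfl) (fun _ => rfl) (fun a l M => by simp)
    (fun M b => Does.push .spk b M) _)).of_eq ?_).mono ?_
  · simp [Mem.get, Mem.set, ht]
  · simp only [Mem.get, List.length_reverse]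
    omega

/-- Compare the unary numbers in `Stk.u'` and `Stk.v'`: afterwards `Stk.tmp` is empty if and only if
they are equal. -/
def compare : Cmd (Alph α β) :=
  each .u' (fun _ => popCase .v' fun o => if o.isSome then .skip else .push .tmp true) ;;
    each .v' fun _ => .push .tmp true

lemma does_compare (i j : ℕ) (M : Mem α β) (hu : M.u' = List.replicate i true)
    (hv : M.v' = List.replicate j true) :
    Does compare M { M with
      u' := []
      v' := []
      tmp := List.replicate (i - j + (j - i)) true ++ M.tmp } (3 * i + 2 * j + 4) := by
  have h₁ : Does (each .u' fun _ => popCase .v' fun o => if o.isSome then .skip else .push .tmp true)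
      M { M with
        u' := []
        v' := List.replicate (j - i) true
        tmp := List.replicate (i - j) true ++ M.tmp } (3 * i + 2) := by
    induction i generalizing j M with
    | zero => exact (Does.each_nil (k := .u') hu).of_eq (by cases M; simp_all)
    | succ i ih =>
      cases j with
      | zero =>
        refine ((Does.each_cons (k := .u') (a := true) (l := List.replicate i true) (b₁ := 2) hu
          (Does.loop_nil (M := M.set .u' (List.replicate i true)) (k := .v') hv rfl
            (Does.push .tmp true _))
          (ih 0 { M with u' := List.replicate i true, tmp := true :: M.tmp } rfl hv)).of_eq
            ?_).mono (by omega)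
        simp [List.replicate_succ, replicate_append_cons]
      | succ j =>
        refine ((Does.each_cons (k := .u') (a := true) (l := List.replicate i true) (b₁ := 2) hu
          (Does.loop_stop (M := M.set .u' (List.replicate i true)) (k := .v') (a := true)
            (l := List.replicate j true) hv rfl (Does.skip _))
          (ih j { M with u' := List.replicate i true, v' := List.replicate j true } rfl rfl)).of_eq
            ?_).mono (by omega)
        simp
  refine ((h₁.seq (Does.each_of_body (k := .v') (fun M _ => { M with tmp := true :: M.tmp })
    (fun l M => { M with tmp := List.replicate l.length true ++ M.tmp }) 1
    (fun _ _ _ => rfl) (fun _ => rfl)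
    (fun a l M => by simp [List.replicate_succ, replicate_append_cons])
    (fun M _ => Does.push .tmp true M) _)).of_eq ?_).mono ?_
  · simp [Mem.get, Mem.set, ← List.append_assoc, add_comm]
  · simp only [Mem.get, List.length_replicate]
    omega

/-- The encoding of the copy in the cone of the edge with ends `i` and `j`. -/
def coneNums (i j : ℕ) : List ℕ := [if i = j then 0 else i + 1, j + 1]

/-- Append the encoding of the copy in the cone of an edge to the output in `Stk.tail`; the ends of
the edge are taken from `Stk.u` and `Stk.v`, and the result of their comparison from `Stk.tmp`. -/
def emitEdge : Cmd (Alph α β) :=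
  popCase .tmp (fun o => if o.isSome then .push .tail true ;; each .u (fun _ => .push .tail true)
    else clear .u) ;;
  clear .tmp ;; .push .tail false ;; .push .tail true ;; each .v (fun _ => .push .tail true) ;;
  .push .tail false

lemma does_emitEdge (i j k : ℕ) (M : Mem α β) (hu : M.u = List.replicate i true)
    (hv : M.v = List.replicate j true) (ht : M.tmp = List.replicate k true) (hk : k = 0 ↔ i = j) :
    Does emitEdge M { M with
      u := []
      v := []
      tmp := []
      tail := (encodeNatList (coneNums i j)).reverse ++ M.tail }
      (2 * i + 2 * j + 2 * k + 13) := by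
  have h₁ : Does (popCase .tmp fun o => if o.isSome then
        .push .tail true ;; each .u (fun _ => .push .tail true) else clear .u) M { M with
      u := []
      tmp := List.replicate (k - 1) true
      tail := List.replicate (if i = j then 0 else i + 1) true ++ M.tail } (2 * i + 4) := by
    cases k with
    | zero =>
      refine ((Does.loop_nil (k := .tmp) ht rfl (does_clear .u M)).of_eq ?_).mono ?_
      · simp [hk.1 rfl, Mem.set, ht]
      · simp [Mem.get, hu]
    | succ k =>
      refine ((Does.loop_stop (k := .tmp) (a := true) (l := List.replicate k true) ht rfl
        ((Does.push .tail true _).seq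
          (Does.each_of_body (k := .u) (fun M _ => { M with tail := true :: M.tail })
            (fun l M => { M with tail := List.replicate l.length true ++ M.tail }) 1
            (fun _ _ _ => rfl) (fun _ => rfl)
            (fun a l M => by simp [List.replicate_succ, replicate_append_cons])
            (fun M _ => Does.push .tail true M) _))).of_eq ?_).mono ?_
      · have hij : i ≠ j := fun h => by simpa using hk.2 h
        simp [hij, Mem.get, Mem.set, hu, List.replicate_succ, replicate_append_cons]
      · simp [Mem.get, Mem.set, hu]
        omega
  refine ((h₁.seq ((does_clear .tmp _).seq ((Does.push .tail false _).seq
    ((Does.push .tail true _).seq ((Does.each_of_body (k := .v)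
      (fun M _ => { M with tail := true :: M.tail })
      (fun l M => { M with tail := List.replicate l.length true ++ M.tail }) 1
      (fun _ _ _ => rfl) (fun _ => rfl)
      (fun a l M => by simp [List.replicate_succ, replicate_append_cons])
      (fun M _ => Does.push .tail true M) _).seq
        (Does.push .tail false _)))))).of_eq ?_).mono ?_
  · simp [Mem.get, Mem.set, hv, coneNums, encodeNatList, List.replicate_succ,
      replicate_append_cons]
  · simp [Mem.get, Mem.set, hv]
    omega

/-- Append the encoding of as many copies of the spokes as there are vertices to the output in
`Stk.rev`. -/
def copySpokesRepeatedly : Cmd (Alph α β) :=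
  each .p (fun _ => .push .n true ;; copySpokes) ;; each .n fun _ => .push .p true

lemma does_copySpokesRepeatedly (k : ℕ) (M : Mem α β) (ht : M.tmp = []) (hn : M.n = [])
    (hp : M.p = List.replicate k true) :
    Does copySpokesRepeatedly M { M with
      rev := (List.replicate k M.spk).flatten.reverse ++ M.rev
      cnt := List.replicate (k * M.spk.count true) true ++ M.cnt }
      ((6 * M.spk.length + 8) * k + 4) := by
  have h₁ : Does (each .p fun _ => .push .n true ;; copySpokes) M { M with
      p := []
      n := List.replicate k true
      rev := (List.replicate k M.spk).flatten.reverse ++ M.rev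
      cnt := List.replicate (k * M.spk.count true) true ++ M.cnt }
      ((6 * M.spk.length + 6) * k + 2) := by
    refine ((Does.each_foldl (k := .p) (fun M _ => { M with
      n := true :: M.n
      rev := M.spk.reverse ++ M.rev
      cnt := List.replicate (M.spk.count true) true ++ M.cnt })
      (fun M' => M'.tmp = [] ∧ M'.spk = M.spk) (6 * M.spk.length + 5) (fun _ _ _ => rfl)
      (fun _ _ h => h) (fun _ _ h => h)
      (fun M' b h => ((Does.push .n true M').seq (does_copySpokes _ h.1)).mono ?_)
      M ⟨ht, rfl⟩).of_eq ?_).mono ?_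
    · have : M'.spk.length = M.spk.length := congrArg _ h.2
      simp only [Mem.set]
      omega
    · have : ∀ (l : List Bool) (M : Mem α β),
          l.foldl (fun M _ => { M with
            n := true :: M.n
            rev := M.spk.reverse ++ M.rev
            cnt := List.replicate (M.spk.count true) true ++ M.cnt }) M = { M with
              n := List.replicate l.length true ++ M.n
              rev := (List.replicate l.length M.spk).flatten.reverse ++ M.rev
              cnt := List.replicate (l.length * M.spk.count true) true ++ M.cnt } := by
        intro l
        induction l with
        | nil => intro M; simp
        | cons a l ih =>
          intro M
          rw [List.foldl_cons, ih]
          simp only [List.length_cons, replicate_append_cons, List.replicate_succ, List.cons_append,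
            ← List.append_assoc, ← List.replicate_add, ← List.reverse_append, Nat.succ_mul,
            List.flatten_cons]
      refine (this _ _).trans ?_
      simp [Mem.get, Mem.set, hn, hp]
    · simp [Mem.get, hp]
  refine ((h₁.seq (Does.each_of_body (k := .n) (fun M _ => { M with p := true :: M.p })
    (fun l M => { M with p := List.replicate l.length true ++ M.p }) 1
    (fun _ _ _ => rfl) (fun _ => rfl)
    (fun a l M => by simp [List.replicate_succ, replicate_append_cons])
    (fun M _ => Does.push .p true M) _)).of_eq ?_).mono ?_
  · simp [Mem.get, Mem.set, hn, hp]
  · simp only [Mem.get, List.length_replicate]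
    ring_nf
    omega

/-- Process all edges in `Stk.src`: for each of them, write its copy in the cone to `Stk.tail` and
`n` copies of the spokes to `Stk.rev`, where `n` is the length of `Stk.p`. The symbol popped by the
loop only signals that there is another edge, and is pushed back. -/
def edgesLoop : Cmd (Alph α β) :=
  each .src fun b => .push .src b ;; readUnary (.push .u true ;; .push .u' true) ;;
    readUnary (.push .v true ;; .push .v' true) ;; compare ;; emitEdge ;; copySpokesRepeatedly

lemma encodeNatList_cons (a : ℕ) (l : List ℕ) :
    encodeNatList (a :: l) = List.replicate a true ++ false :: encodeNatList l := by
  simp [encodeNatList]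

lemma encodeNatList_append (l l' : List ℕ) :
    encodeNatList (l ++ l') = encodeNatList l ++ encodeNatList l' :=
  List.flatMap_append

lemma does_readUnary_u (j : ℕ) (l : List Bool) (M : Mem α β)
    (hM : M.src = List.replicate j true ++ false :: l) (hu : M.u = []) (hu' : M.u' = []) :
    Does (readUnary (.push .u true ;; .push .u' true)) M
      { M with src := l, u := List.replicate j true, u' := List.replicate j true } (3 * j + 2) := by
  refine (Does.readUnary_iterate (fun M => { M with u := true :: M.u, u' := true :: M.u' }) 2
    (fun _ _ => rfl) (fun M => (Does.push .u true M).seq (Does.push .u' true _)) j l M hM).of_eq ?_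
  have : ∀ M : Mem α β, (fun M : Mem α β => { M with u := true :: M.u, u' := true :: M.u' })^[j] M =
      { M with u := List.replicate j true ++ M.u, u' := List.replicate j true ++ M.u' } := by
    clear hM
    induction j with
    | zero => intro M; rfl
    | succ j ih =>
      intro M
      rw [Function.iterate_succ_apply, ih]
      simp [List.replicate_succ, replicate_append_cons]
  rw [this]
  simp [hu, hu']

lemma does_readUnary_v (j : ℕ) (l : List Bool) (M : Mem α β)
    (hM : M.src = List.replicate j true ++ false :: l) (hv : M.v = []) (hv' : M.v' = []) :
    Does (readUnary (.push .v true ;; .push .v' true)) M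
      { M with src := l, v := List.replicate j true, v' := List.replicate j true } (3 * j + 2) := by
  refine (Does.readUnary_iterate (fun M => { M with v := true :: M.v, v' := true :: M.v' }) 2
    (fun _ _ => rfl) (fun M => (Does.push .v true M).seq (Does.push .v' true _)) j l M hM).of_eq ?_
  have : ∀ M : Mem α β, (fun M : Mem α β => { M with v := true :: M.v, v' := true :: M.v' })^[j] M =
      { M with v := List.replicate j true ++ M.v, v' := List.replicate j true ++ M.v' } := by
    clear hM
    induction j with
    | zero => intro M; rfl
    | succ j ih =>
      intro M
      rw [Function.iterate_succ_apply, ih]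
      simp [List.replicate_succ, replicate_append_cons]
  rw [this]
  simp [hv, hv']

lemma does_edgesLoop (N k : ℕ) (l : List (ℕ × ℕ)) (hl : ∀ e ∈ l, e.1 ≤ N ∧ e.2 ≤ N) (M : Mem α β)
    (hsrc : M.src = encodeNatList (l.flatMap fun e => [e.1, e.2])) (hp : M.p = List.replicate k true)
    (hn : M.n = []) (ht : M.tmp = []) (hu : M.u = []) (hu' : M.u' = []) (hv : M.v = [])
    (hv' : M.v' = []) :
    Does edgesLoop M { M with
      src := []
      tail := (encodeNatList (l.flatMap fun e => coneNums e.1 e.2)).reverse ++ M.tail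
      rev := (List.replicate (l.length * k) M.spk).flatten.reverse ++ M.rev
      cnt := List.replicate (l.length * k * M.spk.count true) true ++ M.cnt }
      (((6 * M.spk.length + 8) * k + 19 * N + 30) * l.length + 2) := by
  induction l generalizing M with
  | nil =>
    exact ((Does.each_nil (k := .src) hsrc).of_eq (by cases M; simp_all [encodeNatList])).mono
      (by simp)
  | cons e l ih =>
    obtain ⟨i, j⟩ := e
    have hij := hl (i, j) (by simp)
    simp only at hij
    have hsrc' : M.src = List.replicate i true ++ false :: (List.replicate j true ++ false ::
        encodeNatList (l.flatMap fun e => [e.1, e.2])) := by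
      rw [hsrc]
      simp only [List.flatMap_cons, List.cons_append, List.nil_append, encodeNatList_cons]
    obtain ⟨b, s, hbs⟩ : ∃ b s, M.src = b :: s := List.exists_cons_of_ne_nil (by simp [hsrc'])
    have h₁ := does_readUnary_u (β := β) i _ M hsrc' hu hu'
    have h₂ := does_readUnary_v (β := β) j _ { M with
      src := List.replicate j true ++ false :: encodeNatList (l.flatMap fun e => [e.1, e.2])
      u := List.replicate i true
      u' := List.replicate i true } rfl hv hv'
    have h₃ := does_compare (β := β) i j { M with
      src := encodeNatList (l.flatMap fun e => [e.1, e.2])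
      u := List.replicate i true
      u' := List.replicate i true
      v := List.replicate j true
      v' := List.replicate j true } rfl rfl
    have h₄ := does_emitEdge (β := β) i j (i - j + (j - i)) { M with
      src := encodeNatList (l.flatMap fun e => [e.1, e.2])
      u := List.replicate i true
      v := List.replicate j true
      u' := []
      v' := []
      tmp := List.replicate (i - j + (j - i)) true ++ M.tmp } rfl rfl (by simp [ht]) (by omega)
    have h₅ := does_copySpokesRepeatedly (β := β) k { M with
      src := encodeNatList (l.flatMap fun e => [e.1, e.2])
      u := []
      v := []
      u' := []
      v' := []
      tmp := []
      tail := (encodeNatList (coneNums i j)).reverse ++ M.tail } rfl hn hp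
    have h₆ := ih (fun e he => hl e (by simp [he])) { M with
      src := encodeNatList (l.flatMap fun e => [e.1, e.2])
      u := []
      v := []
      u' := []
      v' := []
      tmp := []
      tail := (encodeNatList (coneNums i j)).reverse ++ M.tail
      rev := (List.replicate k M.spk).flatten.reverse ++ M.rev
      cnt := List.replicate (k * M.spk.count true) true ++ M.cnt } rfl hp hn rfl rfl rfl rfl rfl
    have h₀ : Does (.push .src b) (M.set .src s) M 1 :=
      (Does.push .src b _).of_eq (by cases M; simp_all [Mem.set, Mem.get])
    refine ((Does.each_cons (k := .src) hbs (h₀.seq (h₁.seq (h₂.seq (h₃.seq (h₄.seq h₅))))) h₆).of_eq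
      ?_).mono ?_
    · simp only [List.flatMap_cons, encodeNatList_append, List.reverse_append, List.length_cons,
        List.append_assoc, hu, hv, hu', hv', ht]
      have h1 : ∀ s : List Bool, (List.replicate (l.length * k) s).flatten.reverse ++
          ((List.replicate k s).flatten.reverse ++ M.rev) =
          (List.replicate ((l.length + 1) * k) s).flatten.reverse ++ M.rev := by
        intro s
        rw [Nat.succ_mul, add_comm, List.replicate_add, List.flatten_append, List.reverse_append,
          List.append_assoc]
      have h2 : ∀ m : ℕ, List.replicate (l.length * k * m) true ++
          (List.replicate (k * m) true ++ M.cnt) =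
          List.replicate ((l.length + 1) * k * m) true ++ M.cnt := by
        intro m
        rw [← List.append_assoc, ← List.replicate_add]
        ring_nf
      rw [h1, h2]
    · simp only [List.length_cons]
      generalize (6 * M.spk.length + 8) * k = A
      have h1 : 3 * i + 2 + (3 * j + 2 + (3 * i + 2 * j + 4 +
        (2 * i + 2 * j + 2 * (i - j + (j - i)) + 13 + (A + 4)))) + 2 ≤ A + 19 * N + 30 := by omega
      rw [Nat.mul_succ]
      omega

/-! ### Input and output -/

/-- Split the input into the two parts distinguished by `φ`. -/
def load (φ : α → Bool ⊕ Bool) : Cmd (Alph α β) :=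
  each .inp (fun a => (φ a).elim (fun b => .push .tmp b) fun b => .push .u b) ;;
    each .tmp (fun b => .push .src b) ;; each .u fun b => .push .num b

lemma does_load (φ : α → Bool ⊕ Bool) (M : Mem α β) (ht : M.tmp = []) (hu : M.u = []) :
    Does (load φ) M { M with
      inp := []
      src := M.inp.filterMap (fun a => (φ a).getLeft?) ++ M.src
      num := M.inp.filterMap (fun a => (φ a).getRight?) ++ M.num } (6 * M.inp.length + 6) := by
  have h₁ : Does (each .inp fun a => (φ a).elim (fun b => .push .tmp b) fun b => .push .u b) M
      { M with
        inp := []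
        tmp := (M.inp.filterMap fun a => (φ a).getLeft?).reverse
        u := (M.inp.filterMap fun a => (φ a).getRight?).reverse } (2 * M.inp.length + 2) := by
    refine (Does.each_of_body (k := .inp)
      (fun M a => { M with
        tmp := (φ a).elim (fun b => b :: M.tmp) fun _ => M.tmp
        u := (φ a).elim (fun _ => M.u) fun b => b :: M.u })
      (fun l M => { M with
        tmp := (l.filterMap fun a => (φ a).getLeft?).reverse ++ M.tmp
        u := (l.filterMap fun a => (φ a).getRight?).reverse ++ M.u }) 1
      (fun _ _ _ => rfl) (fun _ => rfl) (fun a l M => ?_) (fun M a => ?_) M).of_eq ?_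
    · simp only [List.filterMap_cons]
      cases φ a <;> simp
    · cases φ a
      · exact Does.push .tmp _ M
      · exact Does.push .u _ M
    · simp [Mem.get, Mem.set, ht, hu]
  refine ((h₁.seq ((Does.each_of_body (k := .tmp) (fun M b => { M with src := b :: M.src })
    (fun l M => { M with src := l.reverse ++ M.src }) 1
    (fun _ _ _ => rfl) (fun _ => rfl) (fun a l M => by simp) (fun M b => Does.push .src b M) _).seq
    (Does.each_of_body (k := .u) (fun M b => { M with num := b :: M.num })
    (fun l M => { M with num := l.reverse ++ M.num }) 1
    (fun _ _ _ => rfl) (fun _ => rfl) (fun a l M => by simp)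
    (fun M b => Does.push .num b M) _))).of_eq ?_).mono ?_
  · simp [Mem.get, Mem.set, ht, hu]
  · have h1 := List.length_filterMap_le (fun a => (φ a).getLeft?) M.inp
    have h2 := List.length_filterMap_le (fun a => (φ a).getRight?) M.inp
    simp only [Mem.get, Mem.set, List.length_reverse]
    omega

/-- Move the contents of `Stk.rev` and `Stk.tail` to the output, which reverses both; `Stk.tail`
comes first since the output is a stack. -/
def unload (ι : Bool → β) : Cmd (Alph α β) :=
  each .tail (fun b => .push .out (ι b)) ;; each .rev fun b => .push .out (ι b)

lemma does_unload (ι : Bool → β) (M : Mem α β) :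
    Does (unload ι) M { M with
      rev := []
      tail := []
      out := (M.rev.reverse ++ M.tail.reverse).map ι ++ M.out }
      (2 * M.rev.length + 2 * M.tail.length + 4) := by
  refine (((Does.each_of_body (k := .tail) (fun M b => { M with out := ι b :: M.out })
    (fun l M => { M with out := l.reverse.map ι ++ M.out }) 1
    (fun _ _ _ => rfl) (fun _ => rfl) (fun a l M => by simp)
    (fun M b => Does.push .out (ι b) M) _).seq
    (Does.each_of_body (k := .rev) (fun M b => { M with out := ι b :: M.out })
    (fun l M => { M with out := l.reverse.map ι ++ M.out }) 1
    (fun _ _ _ => rfl) (fun _ => rfl) (fun a l M => by simp)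
    (fun M b => Does.push .out (ι b) M) _)).of_eq ?_).mono ?_
  · simp [Mem.get, Mem.set]
  · simp only [Mem.get, Mem.set]
    omega

/-! ### The cone as a bit string -/

lemma encodeNatList_spokes (n : ℕ) :
    encodeNatList ((spokes n).flatMap fun e => [(e.1 : ℕ), (e.2 : ℕ)]) = spokeBits n := by
  have h : (spokes n).flatMap (fun e => [(e.1 : ℕ), (e.2 : ℕ)]) =
      (List.range n).flatMap fun v => [0, v + 1] := by
    rw [← List.map_coe_finRange_eq_range, spokes, List.flatMap_map, List.flatMap_map]
    rfl
  rw [h]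
  induction n with
  | zero => rfl
  | succ n ih =>
    rw [List.range_succ, List.flatMap_append, encodeNatList_append, ih (by
      rw [← List.map_coe_finRange_eq_range, spokes, List.flatMap_map, List.flatMap_map]; rfl)]
    simp [encodeNatList, spokeBits]

lemma count_true_spokeBits (n : ℕ) : (spokeBits n).count true = ∑ v : Fin n, ((v : ℕ) + 1) := by
  induction n with
  | zero => rfl
  | succ n ih =>
    rw [Fin.sum_univ_castSucc, spokeBits, List.count_append, ih]
    simp

lemma length_spokeBits_le (n : ℕ) : (spokeBits n).length ≤ (n + 2) * n := by
  induction n with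
  | zero => rfl
  | succ n ih =>
    simp only [spokeBits, List.length_append, List.length_cons, List.length_replicate,
      List.length_nil]
    nlinarith

lemma encodeNatList_replicate_spokes (n k : ℕ) :
    encodeNatList ((List.replicate k (spokes n)).flatten.flatMap fun e => [(e.1 : ℕ), (e.2 : ℕ)]) =
      (List.replicate k (spokeBits n)).flatten := by
  induction k with
  | zero => rfl
  | succ k ih =>
    rw [List.replicate_succ, List.flatten_cons, List.flatMap_append, encodeNatList_append, ih,
      encodeNatList_spokes, List.replicate_succ, List.flatten_cons]

lemma coneNums_eq {n : ℕ} (e : Fin n × Fin n) :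
    coneNums e.1 e.2 = [((coneEdge e).1 : ℕ), ((coneEdge e).2 : ℕ)] := by
  unfold coneNums coneEdge
  by_cases h : e.1 = e.2
  · simp [h]
  · have h' : (e.1 : ℕ) ≠ e.2 := fun h' => h (Fin.ext h')
    simp [h, h']

/-- The edges of a multigraph as pairs of natural numbers. -/
def edgePairs (G : MultiGraph) : List (ℕ × ℕ) := G.edges.map fun e => ((e.1 : ℕ), (e.2 : ℕ))

lemma encode_multiGraph (G : MultiGraph) : encodingMultiGraph.encode G =
    List.replicate G.n true ++
      false :: encodeNatList ((edgePairs G).flatMap fun e => [e.1, e.2]) := by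
  rw [edgePairs, List.flatMap_map, ← encodeNatList_cons]
  rfl

/-- The first part of the encoding of the cone: the number of vertices and the spokes. -/
def headBits (G : MultiGraph) : List Bool :=
  List.replicate (G.n + 1) true ++
    false :: (List.replicate G.multiplicity (spokeBits G.n)).flatten

/-- The second part of the encoding of the cone: the copies of the edges. -/
def tailBits (G : MultiGraph) : List Bool :=
  encodeNatList ((edgePairs G).flatMap fun e => coneNums e.1 e.2)

lemma encode_cone (G : MultiGraph) :
    encodingMultiGraph.encode G.cone = headBits G ++ tailBits G := by
  have h : encodingMultiGraph.encode G.cone =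
      encodeNatList ((G.n + 1) :: G.coneEdges.flatMap fun e => [(e.1 : ℕ), (e.2 : ℕ)]) := rfl
  rw [h, encodeNatList_cons, headBits, tailBits, List.append_assoc, List.cons_append,
    MultiGraph.coneEdges, List.flatMap_append, encodeNatList_append]
  congr 3
  · exact encodeNatList_replicate_spokes _ _
  · rw [edgePairs, List.flatMap_map, List.flatMap_map]
    simp only [coneNums_eq]

lemma length_headBits_le (G : MultiGraph) :
    (headBits G).length ≤ G.n + 2 + (G.m * G.n + 1) * ((G.n + 2) * G.n) := by
  have := Nat.mul_le_mul_left (G.m * G.n + 1) (length_spokeBits_le G.n)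
  simp only [headBits, MultiGraph.multiplicity, List.length_append, List.length_replicate,
    List.length_cons, List.length_flatten, List.map_replicate, List.sum_replicate, smul_eq_mul]
  omega

lemma length_tailBits_le (G : MultiGraph) : (tailBits G).length ≤ (2 * G.n + 4) * G.m := by
  have h : ∀ l : List (Fin G.n × Fin G.n), (encodeNatList
      ((l.map fun e => ((e.1 : ℕ), (e.2 : ℕ))).flatMap fun e => coneNums e.1 e.2)).length ≤
      (2 * G.n + 4) * l.length := by
    intro l
    induction l with
    | nil => simp [encodeNatList]
    | cons e l ih =>
      rw [List.map_cons, List.flatMap_cons, encodeNatList_append, List.length_append,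
        List.length_cons, Nat.mul_succ, add_comm]
      refine add_le_add ih ?_
      simp only [coneNums, encodeNatList, List.flatMap_cons, List.flatMap_nil, List.append_nil,
        List.length_append, List.length_replicate, List.length_cons, List.length_nil]
      split_ifs <;> omega
  exact h G.edges

/-- Write the encoding of the cone to `Stk.rev` and `Stk.tail`, and the shift of the threshold in
unary to `Stk.cnt`. One copy of the spokes is written at first and `n` further copies for every
edge, which makes `m * n + 1`; every copy has as many ones as it contributes to the shift. -/
def coneProgram : Cmd (Alph α β) :=
  readUnary (.push .n true ;; .push .p true ;; .push .rev true) ;; .push .rev true ;;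
    .push .rev false ;; buildSpokes ;; copySpokes ;; edgesLoop ;; clear .spk ;; clear .p

/-- A bound for the running time of `coneProgram` for a multigraph with `n` vertices and `m` edges.
It is defined over any commutative semiring, so that it can be evaluated at the variable of `ℕ[X]`.
-/
def coneTime {R : Type} [CommSemiring R] (n m : R) : R :=
  (((6 * ((n + 2) * n) + 8) * n + 19 * n + 30) * m + (5 * n + 10) * n + 8 * ((n + 2) * n)
    + 6 * n + 18)

lemma does_coneProgram (G : MultiGraph) (x : List β) (y : List Bool) :
    Does coneProgram ({ out := x, num := y, src := encodingMultiGraph.encode G } : Mem α β)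
      { out := x, num := y, rev := (headBits G).reverse, tail := (tailBits G).reverse,
        cnt := List.replicate G.shift true } (coneTime G.n G.m) := by
  have h₁ : Does (readUnary (.push .n true ;; .push .p true ;; .push .rev true))
      ({ out := x, num := y, src := encodingMultiGraph.encode G } : Mem α β)
      { out := x, num := y, src := encodeNatList ((edgePairs G).flatMap fun e => [e.1, e.2]),
        n := List.replicate G.n true, p := List.replicate G.n true,
        rev := List.replicate G.n true } (4 * G.n + 2) := by
    refine (Does.readUnary_iterate (fun M => { M with
        n := true :: M.n
        p := true :: M.p
        rev := true :: M.rev }) 3 (fun _ _ => rfl)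
      (fun M => (Does.push .n true M).seq ((Does.push .p true _).seq (Does.push .rev true _))) G.n _
      _ (encode_multiGraph G)).of_eq ?_
    have : ∀ (j : ℕ) (M : Mem α β), (fun M : Mem α β => { M with
          n := true :: M.n
          p := true :: M.p
          rev := true :: M.rev })^[j] M = { M with
            n := List.replicate j true ++ M.n
            p := List.replicate j true ++ M.p
            rev := List.replicate j true ++ M.rev } := by
      intro j
      induction j with
      | zero => intro M; rfl
      | succ j ih =>
        intro M
        rw [Function.iterate_succ_apply, ih]
        simp [List.replicate_succ, replicate_append_cons]
    rw [this]
    simp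
  have h₂ := does_buildSpokes (β := β) (α := α) G.n {
    out := x
    num := y
    src := encodeNatList ((edgePairs G).flatMap fun e => [e.1, e.2])
    n := List.replicate G.n true
    p := List.replicate G.n true
    rev := false :: true :: List.replicate G.n true } rfl rfl
  have h₃ := does_copySpokes (β := β) (α := α) {
    out := x
    num := y
    src := encodeNatList ((edgePairs G).flatMap fun e => [e.1, e.2])
    p := List.replicate G.n true
    spk := spokeBits G.n ++ []
    rev := false :: true :: List.replicate G.n true } rfl
  have hlt : ∀ e ∈ edgePairs G, e.1 ≤ G.n ∧ e.2 ≤ G.n := by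
    intro e he
    obtain ⟨e, -, rfl⟩ := List.mem_map.1 he
    exact ⟨e.1.2.le, e.2.2.le⟩
  have h₄ := does_edgesLoop (β := β) (α := α) G.n G.n (edgePairs G) hlt {
    out := x
    num := y
    src := encodeNatList ((edgePairs G).flatMap fun e => [e.1, e.2])
    p := List.replicate G.n true
    spk := spokeBits G.n ++ []
    rev := (spokeBits G.n ++ []).reverse ++ false :: true :: List.replicate G.n true
    cnt := List.replicate ((spokeBits G.n ++ []).count true) true ++ [] }
    rfl rfl rfl rfl rfl rfl rfl rfl
  refine ((h₁.seq ((Does.push .rev true _).seq ((Does.push .rev false _).seq (h₂.seq (h₃.seq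
    (h₄.seq ((does_clear .spk _).seq (does_clear .p _)))))))).of_eq ?_).mono ?_
  · have hm : (edgePairs G).length = G.m := by simp [edgePairs]
    have e1 : (headBits G).reverse =
        (List.replicate ((edgePairs G).length * G.n) (spokeBits G.n ++ [])).flatten.reverse ++
        ((spokeBits G.n ++ []).reverse ++ false :: true :: List.replicate G.n true) := by
      rw [headBits, MultiGraph.multiplicity, hm]
      simp [List.replicate_succ, replicate_append_cons]
    have e2 : List.replicate G.shift true =
        List.replicate ((edgePairs G).length * G.n * (spokeBits G.n ++ []).count true) true ++
        (List.replicate ((spokeBits G.n ++ []).count true) true ++ []) := by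
      rw [List.append_nil, List.append_nil, ← List.replicate_add, MultiGraph.shift,
        MultiGraph.multiplicity, hm, count_true_spokeBits, Nat.succ_mul]
    rw [e1, e2, tailBits]
    simp [Mem.set]
  · have hm : (edgePairs G).length = G.m := by simp [edgePairs]
    have hs := length_spokeBits_le G.n
    have hs2 := Nat.mul_le_mul_right G.m (Nat.mul_le_mul_right G.n
      (Nat.add_le_add_right (Nat.mul_le_mul_left 6 hs) 8))
    simp only [Mem.get, Mem.set, List.append_nil, List.length_replicate, coneTime, hm]
    linarith

/-! ### Incrementing a binary counter -/

/-- Increment the binary number in `Stk.num`, the least significant bit being on top. -/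
def increment : Cmd (Alph α β) :=
  .loop .num (· == some true)
      (fun o => if o = some true then .push .tmp false else .push .num true) ;;
    each .tmp fun b => .push .num b

/-- Carry propagation: the trailing ones are replaced by zeros, which are collected in
`Stk.tmp`. -/
lemma exists_does_carry (q : PosNum) (M : Mem α β) (hM : M.num = encodePosNum q) :
    ∃ i l, List.replicate i false ++ l = encodePosNum q.succ ∧ i + l.length ≤ M.num.length + 1 ∧
      i ≤ M.num.length ∧
      Does (.loop .num (· == some true) fun o =>
        if o = some true then .push .tmp false else .push .num true) M
        { M with num := l, tmp := List.replicate i false ++ M.tmp } (2 * i + 2) := by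
  induction q generalizing M with
  | one =>
    refine ⟨1, [true], rfl, by simp [hM, encodePosNum], by simp [hM, encodePosNum], ?_⟩
    exact Does.loop_cont (k := .num) (a := true) (l := []) (b₁ := 1) (b₂ := 2) hM rfl
      (Does.push .tmp false _) (Does.loop_nil rfl rfl (Does.push .num true _))
  | bit0 q _ =>
    refine ⟨0, true :: encodePosNum q, rfl, by simp [hM, encodePosNum], by omega, ?_⟩
    exact Does.loop_stop (k := .num) (a := false) (l := encodePosNum q) hM rfl
      (Does.push .num true _)
  | bit1 q ih =>
    obtain ⟨i, l, h1, h2, h3, h4⟩ :=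
      ih { M with num := encodePosNum q, tmp := false :: M.tmp } rfl
    refine ⟨i + 1, l, ?_, ?_, ?_, ?_⟩
    · rw [List.replicate_succ, List.cons_append, h1]
      rfl
    · simp only [hM, encodePosNum, List.length_cons] at h2 ⊢
      omega
    · simp only [hM, encodePosNum, List.length_cons] at h3 ⊢
      omega
    · refine ((Does.loop_cont (k := .num) (a := true) (l := encodePosNum q) (b₁ := 1) hM rfl
        (Does.push .tmp false _) h4).of_eq ?_).mono (by omega)
      simp [List.replicate_succ, replicate_append_cons]

/-- The bound on the length of the sum is needed to bound the time of repeated increments. -/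
lemma does_increment (K : ℕ) (M : Mem α β) (hM : M.num = encodeNat K) (ht : M.tmp = []) :
    Does increment M { M with num := encodeNat (K + 1) } (4 * M.num.length + 4) ∧
      (encodeNat (K + 1)).length ≤ (encodeNat K).length + 1 := by
  have hsucc : encodeNat (K + 1) = encodePosNum (Num.succ' (K : Num)) := by
    rw [encodeNat, Nat.cast_succ, Num.add_one]
    rfl
  obtain ⟨i, l, h1, h2, h3, h4⟩ : ∃ i l, List.replicate i false ++ l = encodeNat (K + 1) ∧
      i + l.length ≤ M.num.length + 1 ∧ i ≤ M.num.length ∧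
      Does (.loop .num (· == some true) fun o =>
        if o = some true then .push .tmp false else .push .num true) M
        { M with num := l, tmp := List.replicate i false ++ M.tmp } (2 * i + 2) := by
    rw [hsucc]
    rw [encodeNat] at hM
    cases hK : (K : Num) with
    | zero =>
      rw [hK] at hM
      exact ⟨0, [true], rfl, by simp, by simp,
        Does.loop_nil (k := .num) hM rfl ((Does.push .num true M).of_eq (by
          have hM' : M.num = [] := hM
          simp [Mem.get, Mem.set, hM']))⟩
    | pos q =>
      rw [hK] at hM
      exact exists_does_carry q M hM
  constructor
  · refine ((h4.seq (Does.each_of_body (k := .tmp) (fun M b => { M with num := b :: M.num })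
      (fun l M => { M with num := l.reverse ++ M.num }) 1
      (fun _ _ _ => rfl) (fun _ => rfl) (fun a l M => by simp)
      (fun M b => Does.push .num b M) _)).of_eq ?_).mono ?_
    · simp [Mem.get, Mem.set, ht, h1]
    · simp only [Mem.get, ht, List.append_nil, List.length_replicate]
      omega
  · rw [← h1, ← hM]
    simpa using h2

lemma does_each_increment (D K : ℕ) (M : Mem α β) (hM : M.num = encodeNat K)
    (hc : M.cnt = List.replicate D true) (ht : M.tmp = []) :
    Does (each .cnt fun _ => increment) M { M with cnt := [], num := encodeNat (K + D) }
      ((4 * ((encodeNat K).length + D) + 5) * D + 2) ∧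
      (encodeNat (K + D)).length ≤ (encodeNat K).length + D := by
  induction D generalizing K M with
  | zero =>
    exact ⟨((Does.each_nil (k := .cnt) hc).of_eq (by cases M; simp_all)).mono (by omega), by simp⟩
  | succ D ih =>
    obtain ⟨h1, h2⟩ := does_increment (β := β) K { M with cnt := List.replicate D true } hM ht
    obtain ⟨h3, h4⟩ := ih (K + 1)
      { M with cnt := List.replicate D true, num := encodeNat (K + 1) } rfl rfl ht
    have e : K + 1 + D = K + (D + 1) := by omega
    rw [e] at h3 h4
    refine ⟨(Does.each_cons (k := .cnt) (a := true) (l := List.replicate D true) hc h1 h3).mono ?_,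
      by omega⟩
    have h5 : (4 * ((encodeNat (K + 1)).length + D) + 5) * D ≤
        (4 * ((encodeNat K).length + (D + 1)) + 5) * D := Nat.mul_le_mul_right _ (by omega)
    simp only [hM]
    rw [Nat.mul_succ]
    omega

/-! ### Filtering a list of numbers -/

/-- Append the unary number in `Stk.u` to the output in `Stk.rev` if it is less than the number in
`Stk.n`. The comparison pops a symbol of `Stk.n` for each one of the number, which is copied to
`Stk.v` meanwhile; the number is smaller if and only if a symbol remains. The popped symbols are
kept in `Stk.p` and restored at the end. -/
def filterStep : Cmd (Alph α β) :=
  each .u (fun _ => .push .v true ;;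
    popCase .n fun o => if o.isSome then .push .p true else .skip) ;;
  popCase .n (fun o => if o.isSome then
      .push .n true ;; each .v (fun _ => .push .rev true) ;; .push .rev false
    else clear .v) ;;
  each .p fun _ => .push .n true

lemma does_filterStep (n x : ℕ) (M : Mem α β) (hn : M.n = List.replicate n true)
    (hu : M.u = List.replicate x true) (hv : M.v = []) (hp : M.p = []) :
    Does filterStep M { M with
      u := []
      rev := if x < n then false :: (List.replicate x true ++ M.rev) else M.rev }
      (8 * x + 10) := by
  have h₁ : Does (each .u fun _ => .push .v true ;;
      popCase .n fun o => if o.isSome then .push .p true else .skip) M { M with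
        u := []
        v := List.replicate x true
        n := List.replicate (n - x) true
        p := List.replicate (min x n) true } (4 * x + 2) := by
    have : ∀ (x n : ℕ) (M : Mem α β), M.n = List.replicate n true → M.u = List.replicate x true →
        Does (each .u fun _ => .push .v true ;;
          popCase .n fun o => if o.isSome then .push .p true else .skip) M { M with
            u := []
            v := List.replicate x true ++ M.v
            n := List.replicate (n - x) true
            p := List.replicate (min x n) true ++ M.p } (4 * x + 2) := by
      intro x
      induction x with
      | zero =>
        intro n M hn hu
        exact ((Does.each_nil (k := .u) hu).of_eq (by cases M; simp_all)).mono (by omega)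
      | succ x ih =>
        intro n M hn hu
        have hpush := Does.push .v true (M.set .u (List.replicate x true))
        cases n with
        | zero =>
          have h := hpush.seq (Does.loop_nil (k := .n) (cont := fun _ => false)
            (body := fun o => if o.isSome then .push .p true else .skip) hn rfl (Does.skip _))
          refine ((Does.each_cons (k := .u) (a := true) hu h
            (ih 0 { M with u := List.replicate x true, v := true :: M.v } hn rfl)).of_eq ?_).mono
              (by omega)
          simp [List.replicate_succ, replicate_append_cons]
        | succ n =>
          have h := hpush.seq (Does.loop_stop (k := .n) (a := true) (l := List.replicate n true)
            (cont := fun _ => false) (body := fun o => if o.isSome then .push .p true else .skip) hn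
            rfl (Does.push .p true _))
          refine ((Does.each_cons (k := .u) (a := true) hu h
            (ih n { M with
              u := List.replicate x true
              v := true :: M.v
              n := List.replicate n true
              p := true :: M.p } rfl rfl)).of_eq ?_).mono (by omega)
          simp [List.replicate_succ, replicate_append_cons]
    simpa only [hv, hp, List.append_nil] using this x n M hn hu
  have h₂ : Does (popCase .n fun o => if o.isSome then
      .push .n true ;; each .v (fun _ => .push .rev true) ;; .push .rev false
      else clear .v) { M with
        u := []
        v := List.replicate x true
        n := List.replicate (n - x) true
        p := List.replicate (min x n) true } { M with
        u := []
        v := []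
        n := List.replicate (n - x) true
        p := List.replicate (min x n) true
        rev := if x < n then false :: (List.replicate x true ++ M.rev) else M.rev } (2 * x + 5) := by
    by_cases hx : x < n
    · obtain ⟨k, hk⟩ : ∃ k, n - x = k + 1 := ⟨n - x - 1, by omega⟩
      rw [hk, if_pos hx]
      refine ((Does.loop_stop (k := .n) (a := true) (l := List.replicate k true) rfl rfl
        ((Does.push .n true _).seq ((Does.each_of_body (k := .v)
          (fun M _ => { M with rev := true :: M.rev })
          (fun l M => { M with rev := List.replicate l.length true ++ M.rev }) 1
          (fun _ _ _ => rfl) (fun _ => rfl)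
          (fun a l M => by simp [List.replicate_succ, replicate_append_cons])
          (fun M _ => Does.push .rev true M) _).seq (Does.push .rev false _)))).of_eq ?_).mono ?_
      · simp [Mem.get, Mem.set, List.replicate_succ]
      · simp [Mem.get, Mem.set]
        omega
    · rw [show n - x = 0 by omega, if_neg hx]
      exact (Does.loop_nil (k := .n) rfl rfl (does_clear .v _)).mono (by simp [Mem.get])
  refine ((h₁.seq (h₂.seq (Does.each_of_body (k := .p) (fun M _ => { M with n := true :: M.n })
    (fun l M => { M with n := List.replicate l.length true ++ M.n }) 1
    (fun _ _ _ => rfl) (fun _ => rfl)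
    (fun a l M => by simp [List.replicate_succ, replicate_append_cons])
    (fun M _ => Does.push .n true M) _))).of_eq ?_).mono ?_
  · simp only [Mem.get, Mem.set, List.length_replicate, ← List.replicate_add, hn, hv, hp]
    rw [show min x n + (n - x) = n by omega]
  · simp only [Mem.get, List.length_replicate]
    omega

/-- Append the numbers from the list in `Stk.num` that are less than the number in `Stk.n` to the
output in `Stk.rev`. -/
def filterLoop : Cmd (Alph α β) :=
  each .num fun b => if b then .push .u true else filterStep

/-- The loop first moves the ones of a number to `Stk.u`. -/
lemma Does.filterLoop_replicate {x b : ℕ} {l : List Bool} {M M₁ : Mem α β}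
    (hM : M.num = List.replicate x true ++ l)
    (h : Does filterLoop { M with num := l, u := List.replicate x true ++ M.u } M₁ b) :
    Does filterLoop M M₁ (2 * x + b) := by
  induction x generalizing M with
  | zero =>
    rw [List.replicate_zero, List.nil_append] at hM
    subst hM
    exact h.mono (by omega)
  | succ x ih =>
    refine (Does.each_cons (k := .num) (a := true) (l := List.replicate x true ++ l)
      (body := fun b => if b then .push .u true else filterStep) hM
      (Does.push .u true _) (ih (M := { M with
        num := List.replicate x true ++ l
        u := true :: M.u }) rfl ?_)).mono (by omega)
    rw [List.replicate_succ, List.cons_append, ← replicate_append_cons] at h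
    exact h

lemma does_filterLoop (n N : ℕ) (l : List ℕ) (hl : ∀ x ∈ l, x ≤ N) (M : Mem α β)
    (hM : M.num = encodeNatList l) (hn : M.n = List.replicate n true) (hu : M.u = [])
    (hv : M.v = []) (hp : M.p = []) :
    Does filterLoop M { M with
      num := []
      rev := (encodeNatList (l.filter (· < n))).reverse ++ M.rev }
      ((10 * N + 11) * l.length + 2) := by
  induction l generalizing M with
  | nil =>
    exact ((Does.each_nil (k := .num) hM).of_eq (by cases M; simp_all [encodeNatList])).mono
      (by simp)
  | cons x l ih =>
    rw [encodeNatList_cons] at hM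
    have hx := hl x (by simp)
    have h₁ := does_filterStep (β := β) n x
      { M with num := encodeNatList l, u := List.replicate x true ++ M.u } hn (by simp [hu]) hv hp
    have h₂ := ih (fun y hy => hl y (by simp [hy])) { M with
      num := encodeNatList l
      u := []
      rev := if x < n then false :: (List.replicate x true ++ M.rev) else M.rev } rfl hn rfl hv hp
    refine ((Does.filterLoop_replicate hM
      (Does.each_cons (k := .num) (a := false) (l := encodeNatList l) rfl h₁ h₂)).of_eq ?_).mono ?_
    · rw [List.filter_cons]
      by_cases h : x < n
      · simp [h, hu, encodeNatList_cons]
      · simp [h, hu]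
    · rw [List.length_cons, Nat.mul_succ]
      omega

/-! ### Polynomial-time computability of the reduction -/

open Polynomial in
/-- A form of `polyTimeComputable_of_exec` where the time bound is part of the specification. All
stacks except the output have to be empty in the end. -/
theorem polyTimeComputable_of_does [Fintype α] [Fintype β] {A B : Type} (ea : A → List α)
    (eb : B → List β) (f : A → B) (c : Cmd (Alph α β)) (q : ℕ[X])
    (h : ∀ a, Does c { inp := ea a } { out := eb (f a) } (q.eval (ea a).length)) :
    PolyTimeComputable ea eb f := by
  refine polyTimeComputable_of_exec (Γ := Alph α β) .inp .out ea eb f c q fun a => ?_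
  have h0 : (fun _ => [] : ∀ k, List (Alph α β k)) = Mem.get {} := by
    funext k
    cases k <;> rfl
  obtain ⟨t, ht, he⟩ := h a
  refine ⟨t, ht, ?_⟩
  rw [h0, Mem.update_get, Mem.update_get]
  exact he

lemma length_le_length_encodeNatList (l : List ℕ) : l.length ≤ (encodeNatList l).length := by
  induction l with
  | nil => simp
  | cons a l ih =>
    rw [encodeNatList_cons, List.length_append, List.length_cons, List.length_cons]
    omega

lemma length_encodeNatList_filter_le (P : ℕ → Bool) (l : List ℕ) :
    (encodeNatList (l.filter P)).length ≤ (encodeNatList l).length := by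
  induction l with
  | nil => simp
  | cons a l ih =>
    rw [List.filter_cons]
    split_ifs
    · simpa only [encodeNatList_cons, List.length_append, List.length_cons, add_le_add_iff_left,
        add_le_add_iff_right] using ih
    · refine ih.trans ?_
      rw [encodeNatList_cons, List.length_append, List.length_cons]
      omega

lemma n_add_m_le_length_encode (G : MultiGraph) :
    G.n + G.m ≤ (encodingMultiGraph.encode G).length := by
  have h := length_le_length_encodeNatList ((edgePairs G).flatMap fun e => [e.1, e.2])
  have h2 : ((edgePairs G).flatMap fun e => [e.1, e.2]).length = G.m * 2 := by
    simp [edgePairs, List.length_flatMap, Function.comp_def]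
  rw [encode_multiGraph, List.length_append, List.length_replicate, List.length_cons]
  omega

/-- A bound for the shift of the threshold. -/
def shiftBound {R : Type} [CommSemiring R] (n m : R) : R := (m * n + 1) * ((n + 2) * n)

lemma shift_le_shiftBound (G : MultiGraph) : G.shift ≤ shiftBound G.n G.m := by
  refine Nat.mul_le_mul_left _ ?_
  rw [← count_true_spokeBits]
  exact List.count_le_length.trans (length_spokeBits_le _)

/-- A bound for the length of the encoding of the cone. -/
def sizeBound {R : Type} [CommSemiring R] (n m : R) : R :=
  n + 2 + (m * n + 1) * ((n + 2) * n) + (2 * n + 4) * m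

lemma length_bits_le (G : MultiGraph) :
    (headBits G).length + (tailBits G).length ≤ sizeBound G.n G.m :=
  add_le_add (length_headBits_le G) (length_tailBits_le G)

section Bounds

variable {n m L : ℕ} (hn : n ≤ L) (hm : m ≤ L)

include hn hm

lemma coneTime_le : coneTime n m ≤ coneTime L L := by
  unfold coneTime
  gcongr

lemma shiftBound_le : shiftBound n m ≤ shiftBound L L := by
  unfold shiftBound
  gcongr

lemma sizeBound_le : sizeBound n m ≤ sizeBound L L := by
  unfold sizeBound
  gcongr

end Bounds

open Polynomial in
theorem polyTimeComputable_cone :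
    PolyTimeComputable encodingMultiGraph.encode encodingMultiGraph.encode MultiGraph.cone := by
  refine polyTimeComputable_of_does _ _ _
    (load Sum.inl ;; coneProgram ;; clear .cnt ;; unload id)
    (6 * X + 12 + coneTime X X + 2 * shiftBound X X + 2 * sizeBound X X) fun G => ?_
  set s := encodingMultiGraph.encode G with hs
  have h₁ : Does (load Sum.inl) ({ inp := s } : Mem Bool Bool) { src := s } (6 * s.length + 6) :=
    (does_load Sum.inl _ rfl rfl).of_eq (by simp)
  refine ((h₁.seq ((does_coneProgram G [] []).seq ((does_clear .cnt _).seq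
    (does_unload id _)))).of_eq ?_).mono ?_
  · simp [Mem.set, encode_cone]
  · have h := n_add_m_le_length_encode G
    rw [← hs] at h
    have h1 := coneTime_le (n := G.n) (m := G.m) (L := s.length) (by omega) (by omega)
    have h2 := (shift_le_shiftBound G).trans
      (shiftBound_le (n := G.n) (m := G.m) (L := s.length) (by omega) (by omega))
    have h3 := (length_bits_le G).trans
      (sizeBound_le (n := G.n) (m := G.m) (L := s.length) (by omega) (by omega))
    have e1 : (coneTime X X : ℕ[X]).eval s.length = coneTime s.length s.length := by
      simp [coneTime]
    have e2 : (shiftBound X X : ℕ[X]).eval s.length = shiftBound s.length s.length := by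
      simp [shiftBound]
    have e3 : (sizeBound X X : ℕ[X]).eval s.length = sizeBound s.length s.length := by
      simp [sizeBound]
    simp only [eval_add, eval_mul, eval_ofNat, eval_X, e1, e2, e3, Mem.get, Mem.set,
      List.length_reverse, List.length_replicate]
    omega

/-- Add the unary number in `Stk.cnt` to the binary number in `Stk.num` and move the result to the
output. -/
def addAndUnload (ι : Bool → β) : Cmd (Alph α β) :=
  (each .cnt fun _ => increment) ;; each .num (fun b => .push .tmp b) ;;
    each .tmp fun b => .push .out (ι b)

lemma does_addAndUnload (ι : Bool → β) (D K : ℕ) (M : Mem α β) (hM : M.num = encodeNat K)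
    (hc : M.cnt = List.replicate D true) (ht : M.tmp = []) :
    Does (addAndUnload ι) M
      { M with cnt := [], num := [], out := (encodeNat (K + D)).map ι ++ M.out }
      ((4 * ((encodeNat K).length + D) + 5) * D + 4 * ((encodeNat K).length + D) + 6) := by
  obtain ⟨h₁, h₂⟩ := does_each_increment D K M hM hc ht
  refine ((h₁.seq ((Does.each_of_body (k := .num) (fun M b => { M with tmp := b :: M.tmp })
      (fun l M => { M with tmp := l.reverse ++ M.tmp }) 1
      (fun _ _ _ => rfl) (fun _ => rfl) (fun a l M => by simp)
      (fun M b => Does.push .tmp b M) _).seq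
    (Does.each_of_body (k := .tmp) (fun M b => { M with out := ι b :: M.out })
      (fun l M => { M with out := l.reverse.map ι ++ M.out }) 1
      (fun _ _ _ => rfl) (fun _ => rfl) (fun a l M => by simp)
      (fun M b => Does.push .out (ι b) M) _))).of_eq ?_).mono ?_
  · simp [Mem.get, Mem.set, ht]
  · simp only [Mem.get, Mem.set, ht, List.append_nil, List.length_reverse]
    omega

open Polynomial in
theorem polyTimeComputable_cone_shift :
    PolyTimeComputable encodingMultiGraphNat.encode encodingMultiGraphNat.encode
      (fun x : MultiGraph × ℕ => (x.1.cone, x.2 + x.1.shift)) := by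
  refine polyTimeComputable_of_does _ _ _
    (load id ;; coneProgram ;; addAndUnload Sum.inr ;; unload Sum.inl)
    (6 * X + 16 + coneTime X X + (4 * (X + shiftBound X X) + 5) * shiftBound X X +
      4 * (X + shiftBound X X) + 2 * sizeBound X X) ?_
  rintro ⟨G, K⟩
  have hs : encodingMultiGraphNat.encode (G, K) =
      (encodingMultiGraph.encode G).map Sum.inl ++ (encodeNat K).map Sum.inr := rfl
  have hs' : encodingMultiGraphNat.encode (G.cone, K + G.shift) =
      (headBits G ++ tailBits G).map Sum.inl ++ (encodeNat (K + G.shift)).map Sum.inr := by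
    rw [← encode_cone]
    rfl
  have hlen := congrArg List.length hs
  rw [List.length_append, List.length_map, List.length_map] at hlen
  set s := encodingMultiGraphNat.encode (G, K)
  have h₁ : Does (load id) ({ inp := s } : Mem (Bool ⊕ Bool) (Bool ⊕ Bool))
      { src := encodingMultiGraph.encode G, num := encodeNat K } (6 * s.length + 6) :=
    (does_load id _ rfl rfl).of_eq (by simp [hs, Function.comp_def])
  refine ((h₁.seq ((does_coneProgram G [] (encodeNat K)).seq
    ((does_addAndUnload Sum.inr G.shift K _ rfl rfl rfl).seq
      (does_unload Sum.inl _)))).of_eq ?_).mono ?_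
  · simp [hs']
  · have h := n_add_m_le_length_encode G
    have h1 := coneTime_le (n := G.n) (m := G.m) (L := s.length) (by omega) (by omega)
    have h2 := (shift_le_shiftBound G).trans
      (shiftBound_le (n := G.n) (m := G.m) (L := s.length) (by omega) (by omega))
    have h3 := (length_bits_le G).trans
      (sizeBound_le (n := G.n) (m := G.m) (L := s.length) (by omega) (by omega))
    have h4 : (4 * ((encodeNat K).length + G.shift) + 5) * G.shift ≤
        (4 * (s.length + shiftBound s.length s.length) + 5) * shiftBound s.length s.length :=
      Nat.mul_le_mul (by omega) h2
    have e1 : (coneTime X X : ℕ[X]).eval s.length = coneTime s.length s.length := by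
      simp [coneTime]
    have e2 : (shiftBound X X : ℕ[X]).eval s.length = shiftBound s.length s.length := by
      simp [shiftBound]
    have e3 : (sizeBound X X : ℕ[X]).eval s.length = sizeBound s.length s.length := by
      simp [sizeBound]
    simp only [eval_add, eval_mul, eval_ofNat, eval_X, e1, e2, e3, List.length_reverse]
    omega

lemma does_readUnary_n (j : ℕ) (l : List Bool) (M : Mem α β)
    (hM : M.src = List.replicate j true ++ false :: l) (hn : M.n = []) :
    Does (readUnary (.push .n true)) M { M with src := l, n := List.replicate j true }
      (2 * j + 2) := by
  refine (Does.readUnary_iterate (fun M => { M with n := true :: M.n }) 1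
    (fun _ _ => rfl) (fun M => Does.push .n true M) j l M hM).of_eq ?_
  have : ∀ M : Mem α β, (fun M : Mem α β => { M with n := true :: M.n })^[j] M =
      { M with n := List.replicate j true ++ M.n } := by
    clear hM
    induction j with
    | zero => intro M; rfl
    | succ j ih =>
      intro M
      rw [Function.iterate_succ_apply, ih]
      simp [List.replicate_succ, replicate_append_cons]
  rw [this]
  simp [hn]

open Polynomial in
theorem polyTimeComputable_pullback :
    PolyTimeComputable (encodeWithOrdering MultiGraph.cone) (id : List Bool → List Bool)
      (fun x : Σ G : MultiGraph, LinOrdering G.cone.m => encodeOrdering (x.1.pullback x.2)) := by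
  refine polyTimeComputable_of_does _ _ _
    (load id ;; readUnary (.push .n true) ;; clear .src ;; filterLoop ;; clear .n ;; unload id)
    ((10 * X + 11) * X + 14 * X + 18) ?_
  rintro ⟨G, σ⟩
  set l := (List.finRange G.cone.m).map fun i => (σ.symm i : ℕ) with hl
  have hs : encodeWithOrdering MultiGraph.cone ⟨G, σ⟩ =
      (encodingMultiGraph.encode G).map Sum.inl ++ (encodeNatList l).map Sum.inr := rfl
  have hs' : encodeOrdering (G.pullback σ) = encodeNatList (l.filter (· < G.n)) := by
    rw [hl, ← MultiGraph.map_finRange_pullback]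
    rfl
  have hlen := congrArg List.length hs
  rw [List.length_append, List.length_map, List.length_map] at hlen
  set s := encodeWithOrdering MultiGraph.cone ⟨G, σ⟩
  have hle : ∀ x ∈ l, x ≤ l.length := by
    intro x hx
    obtain ⟨i, -, rfl⟩ := List.mem_map.1 hx
    simp [hl]
  have hsrc := encode_multiGraph G
  have h₁ : Does (load id) ({ inp := s } : Mem (Bool ⊕ Bool) Bool)
      { src := encodingMultiGraph.encode G, num := encodeNatList l } (6 * s.length + 6) :=
    (does_load id _ rfl rfl).of_eq (by simp [hs, Function.comp_def])
  refine ((h₁.seq ((does_readUnary_n G.n _ _ hsrc rfl).seq ((does_clear .src _).seq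
    ((does_filterLoop G.n l.length l hle _ rfl rfl rfl rfl rfl).seq
      ((does_clear .n _).seq (does_unload id _)))))).of_eq ?_).mono ?_
  · simp [Mem.set, hs']
  · have h1 := n_add_m_le_length_encode G
    have h2 := length_le_length_encodeNatList l
    have h3 := length_encodeNatList_filter_le (· < G.n) l
    have h4 := congrArg List.length hsrc
    rw [List.length_append, List.length_cons] at h4
    have h5 : (10 * l.length + 11) * l.length ≤ (10 * s.length + 11) * s.length :=
      Nat.mul_le_mul (by omega) (by omega)
    simp only [eval_add, eval_mul, eval_ofNat, eval_X, List.length_reverse, Mem.get, Mem.set,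
      List.length_replicate, List.append_nil, List.length_nil]
    omega

end StackProgram

theorem mainTheorem5 :
    ∃ (f : MultiGraph → MultiGraph) (d : MultiGraph → ℕ)
      (g : ∀ G : MultiGraph, LinOrdering (f G).m → LinOrdering G.n),
      -- the instance map is polynomial-time computable, for the optimization problems ...
      PolyTimeComputable encodingMultiGraph.encode encodingMultiGraph.encode f ∧
      -- ... and, with the thresholds, for the decision problems
      PolyTimeComputable encodingMultiGraphNat.encode encodingMultiGraphNat.encode
        (fun p : MultiGraph × ℕ => (f p.1, p.2 + d p.1)) ∧
      -- so is the map that carries orderings back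
      PolyTimeComputable (encodeWithOrdering f) (id : List Bool → List Bool)
        (fun p : Σ G : MultiGraph, LinOrdering (f G).m => encodeOrdering (g p.1 p.2)) ∧
      -- the decision problems correspond
      (∀ (G : MultiGraph) (K : ℕ),
        (∃ π : LinOrdering G.n, mlvcCost G π ≤ K) ↔
          ∃ σ : LinOrdering (f G).m, graphicMlopCost (f G) σ ≤ K + d G) ∧
      -- optimal orderings are carried to optimal orderings
      (∀ (G : MultiGraph) (σ : LinOrdering (f G).m),
        IsOptimal (graphicMlopCost (f G)) σ → IsOptimal (mlvcCost G) (g G σ)) := by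
  exact ⟨MultiGraph.cone, MultiGraph.shift, MultiGraph.pullback,
    StackProgram.polyTimeComputable_cone, StackProgram.polyTimeComputable_cone_shift,
    StackProgram.polyTimeComputable_pullback, MultiGraph.exists_mlvcCost_le_iff,
    fun G σ hσ => G.isOptimal_copyOrdering σ hσ _⟩
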